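/- **Setting.** Let $U\subseteq\mathbb R^N$ be open, with coordinates $u^1,\dots,u^N$. Let $\mathcal A=\mathcal A_U$ be the algebra of differential polynomials, i.e. polynomials in the jet variables $u^{i,\sigma}$ ($1\le i\le N$, $\sigma\ge 1$) with coefficients in $C^\infty(U)$, and let $\mathcal A_d$ be its homogeneous part of degree $d$, where $\deg u^{i,\sigma}=\sigma$. Put $u^{i,0}=u^i$ and $\partial_x=\sum_{\sigma\ge0}u^{i,\sigma+1}\,\partial/\partial u^{i,\sigma}$. Operators are formal power series in $\epsilon$ whose coefficients are formal pseudo-differential operators in $\partial_x$ over $\mathcal A$; in particular $\partial_x^{-1}$ is the two-sided inverse of $\partial_x$. Summation over repeated indices is understood, $^*$ denotes the formal adjoint, and for $F\in\mathcal A[[\epsilon]]$ we write $(\ell_F)_i=\sum_{\sigma}\frac{\partial F}{\partial u^{i,\sigma}}\partial_x^\sigma$. A *weakly non-local bivector of localizable shape* in the coordinates $(x,u)$ is a matrix of operators $$P^{ij}=\sum_{d=1}^\infty\epsilon^{d-1}\Big(\sum_{s=0}^dP^{ij}_{d,d-s}\partial_x^s+u^{i,1}\partial_x^{-1}V_d^j+V_d^i\partial_x^{-1}u^{j,1}\Big),\qquad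 P^{ij}_{d,d-s}\in\mathcal A_{d-s},\quad V_d^i\in\mathcal A_d,$$ whose local part $P_{loc}^{ij}=\sum_{d}\epsilon^{d-1}\sum_sP^{ij}_{d,d-s}\partial_x^s$ is skew-symmetric, $(P_{loc}^{ij})^*=-P_{loc}^{ji}$ (the non-local part is then automatically skew-symmetric). A *Miura-reciprocal transformation* from $(x,u)$, $u\in U$, to $(y,w)$, $w\in W$, where $W\subseteq\mathbb R^N$ is open, is given by $$dy=B\,dx,\quad B=\sum_{k\ge0}\epsilon^kH_k,\qquad w^i=Q^i=\sum_{k\ge0}\epsilon^kK^i_k,\qquad H_k,K^i_k\in\mathcal A_k,$$ where $H_0$ vanishes nowhere on $U$, $\det(\partial K_0^i/\partial u^k)$ vanishes nowhere on $U$, and $K_0=(K_0^1,\dots,K_0^N)$ maps $U$ bijectively onto $W$. Accordingly $\partial_y=B^{-1}\partial_x$, $\partial_y^{-1}=\partial_x^{-1}\circ B$ and $w^{i,\sigma}=(B^{-1}\partial_x)^\sigma Q^i$; a smooth function $f$ on $W$ is substituted by Taylor expansion of $f(Q)$ at $K_0$ in powers of $\epsilon$. Bivectors transform by $$P\longmapsto\tilde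 P,\qquad\tilde P^{hk}=\frac1B\,\mathcal D^h_i\circ P^{ij}\circ(\mathcal D^*)^k_j,\qquad\mathcal D^j_i=B\,(\ell_{Q^j})_i-(\partial_xQ^j)\,\partial_x^{-1}\circ(\ell_B)_i .$$ **Proposition.** Any Miura-reciprocal transformation $dy=B\,dx$, $w^i=Q^i$ sends every weakly non-local bivector $P$ of localizable shape to a weakly non-local bivector of localizable shape in the coordinates $(y,w)$. That is, there are $\tilde P^{ij}_{d,d-s}\in(\mathcal A_W)_{d-s}$ and $\tilde V^i_d\in(\mathcal A_W)_d$ (differential polynomials in $w$ and its $y$-derivatives with coefficients in $C^\infty(W)$), with skew-symmetric local part in the coordinates $(y,w)$, such that, after the above substitution, $$\tilde P^{ij}=\sum_{d=1}^\infty\epsilon^{d-1}\Big(\sum_{s=0}^d\tilde P^{ij}_{d,d-s}\partial_y^s+w^{i,1}\partial_y^{-1}\tilde V_d^j+\tilde V_d^i\partial_y^{-1}w^{j,1}\Big).$$ -/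

import Mathlib

open scoped ContDiff

noncomputable section

namespace MiuraReciprocal

/-! ### Smooth functions on an open set of `ℝ^N` -/

/-- Extension by zero of a function on `U` to the whole of `ℝ^N` (only its values on `U` matter). -/
def extend {N : ℕ} {U : TopologicalSpace.Opens (Fin N → ℝ)} (f : U → ℝ) : (Fin N → ℝ) → ℝ :=
  open Classical in fun x => if h : x ∈ U then f ⟨x, h⟩ else 0

theorem extend_eqOn {N : ℕ} {U : TopologicalSpace.Opens (Fin N → ℝ)} (f : U → ℝ)
    (g : (Fin N → ℝ) → ℝ) (h : ∀ x : U, f x = g x) : Set.EqOn (extend f) g U := by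
  intro x hx
  have hx' : x ∈ U := hx
  simp only [extend, hx', dif_pos]
  exact h ⟨x, hx⟩

/-- The `ℝ`-algebra `C^∞(U)` of smooth real functions on the open set `U ⊆ ℝ^N`. -/
def smoothSubalgebra {N : ℕ} (U : TopologicalSpace.Opens (Fin N → ℝ)) :
    Subalgebra ℝ (U → ℝ) where
  carrier := {f | ContDiffOn ℝ ∞ (extend f) U}
  mul_mem' {f g} hf hg := by
    refine ContDiffOn.congr (ContDiffOn.mul hf hg) (extend_eqOn _ _ fun x => ?_)
    simp [extend]
  add_mem' {f g} hf hg := by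
    refine ContDiffOn.congr (ContDiffOn.add hf hg) (extend_eqOn _ _ fun x => ?_)
    simp [extend]
  algebraMap_mem' r :=
    ContDiffOn.congr (f := fun _ => r) contDiffOn_const (extend_eqOn _ _ fun _ => rfl)

/-- `C^∞(U)` as a type. -/
def Smooth {N : ℕ} (U : TopologicalSpace.Opens (Fin N → ℝ)) : Type := smoothSubalgebra U

instance {N : ℕ} (U : TopologicalSpace.Opens (Fin N → ℝ)) : CommRing (Smooth U) :=
  inferInstanceAs (CommRing (smoothSubalgebra U))

instance {N : ℕ} (U : TopologicalSpace.Opens (Fin N → ℝ)) : Algebra ℝ (Smooth U) :=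
  inferInstanceAs (Algebra ℝ (smoothSubalgebra U))

theorem Smooth.ext {N : ℕ} {U : TopologicalSpace.Opens (Fin N → ℝ)} {f g : Smooth U}
    (h : ∀ x : U, f.1 x = g.1 x) : f = g := Subtype.ext (funext h)

/-- The partial derivative `∂/∂u^i : C^∞(U) → C^∞(U)`. -/
def partialDeriv {N : ℕ} {U : TopologicalSpace.Opens (Fin N → ℝ)} (i : Fin N) :
    Smooth U →+ Smooth U where
  toFun f := ⟨fun x => fderiv ℝ (extend f.1) x (Pi.single i 1), by
    have h : ContDiffOn ℝ ∞ (fun x => fderiv ℝ (extend f.1) x (Pi.single i 1)) U :=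
      ContDiffOn.clm_apply (ContDiffOn.fderiv_of_isOpen f.2 U.2 (by simp)) contDiffOn_const
    exact h.congr (extend_eqOn _ _ fun _ => rfl)⟩
  map_zero' := by
    refine Smooth.ext fun x => ?_
    have h : (extend (0 : U → ℝ)) = fun _ => 0 := by
      funext y; simp [extend]
    change fderiv ℝ (extend (0 : U → ℝ)) x (Pi.single i 1) = 0
    simp [h]
  map_add' f g := by
    refine Smooth.ext fun x => ?_
    have hd : ∀ k : Smooth U, DifferentiableAt ℝ (extend k.1) x := fun k =>
      ((ContDiffOn.contDiffAt k.2 (U.2.mem_nhds x.2)).differentiableAt (by simp))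
    have h : extend (f + g).1 = extend f.1 + extend g.1 := by
      funext y
      by_cases hy : y ∈ U
      · simp only [extend, hy, dif_pos, Pi.add_apply]; rfl
      · simp [extend, hy]
    simp only [h, fderiv_add (hd f) (hd g)]
    rfl

/-- The pull-back `f ↦ f ∘ k` of a smooth function on `W` along a smooth map `k : U → W`. -/
def pullback {N : ℕ} {U W : TopologicalSpace.Opens (Fin N → ℝ)} (k : Fin N → Smooth U)
    (hk : ∀ x : U, (fun i => (k i).1 x) ∈ W) (f : Smooth W) : Smooth U :=
  ⟨fun x => f.1 ⟨fun i => (k i).1 x, hk x⟩, by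
    have hkU : ContDiffOn ℝ ∞ (fun x i => extend (k i).1 x) U :=
      contDiffOn_pi.2 fun i => (k i).2
    have hval : ∀ x : U, (fun i => extend (k i).1 x) = fun i => (k i).1 x := by
      intro x; funext i; simp [extend]
    have hmaps : Set.MapsTo (fun x i => extend (k i).1 x) U W := by
      intro x hx
      have h := hk ⟨x, hx⟩
      rw [← hval ⟨x, hx⟩] at h
      exact h
    have hcomp : ContDiffOn ℝ ∞ (extend f.1 ∘ fun x i => extend (k i).1 x) U :=
      ContDiffOn.comp f.2 hkU hmaps
    refine hcomp.congr (extend_eqOn _ _ fun x => ?_)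
    have h := hk x
    simp only [Function.comp, hval x]
    simp [extend, h]⟩

/-! ### Differential polynomials -/

/-- Differential polynomials on `U`: polynomials with coefficients in `C^∞(U)` in the jet variables
`u^{i,σ}`, `1 ≤ i ≤ N`, `σ ≥ 1`.  The variable with index `(i, s)` is `u^{i,s+1}`. -/
abbrev DiffPoly {N : ℕ} (U : TopologicalSpace.Opens (Fin N → ℝ)) : Type :=
  MvPolynomial (Fin N × ℕ) (Smooth U)

/-- `f` is homogeneous of differential degree `d`, where `deg u^{i,σ} = σ`; that is, `f ∈ 𝒜_d`. -/
def HasDegree {N : ℕ} {U : TopologicalSpace.Opens (Fin N → ℝ)} (f : DiffPoly U) (d : ℕ) : Prop :=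
  MvPolynomial.IsWeightedHomogeneous (fun v : Fin N × ℕ => v.2 + 1) f d

/-- The partial derivative `∂/∂u^{i,σ}` on differential polynomials.  For `σ = 0` it acts on the
coefficients. -/
def jetPartial {N : ℕ} {U : TopologicalSpace.Opens (Fin N → ℝ)} (i : Fin N) :
    ℕ → DiffPoly U → DiffPoly U
  | 0, f => AddMonoidAlgebra.map (partialDeriv i) f
  | s + 1, f => MvPolynomial.pderiv (i, s) f

/-- The total derivative `∂_x = ∑ u^{i,σ+1} ∂/∂u^{i,σ}` on differential polynomials: the part
`σ = 0` acts on the coefficients, and the part `σ ≥ 1` is the `C^∞(U)`-linear derivation which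
sends `u^{i,σ}` to `u^{i,σ+1}`. -/
def totalDeriv {N : ℕ} {U : TopologicalSpace.Opens (Fin N → ℝ)} : DiffPoly U →+ DiffPoly U where
  toFun f := ∑ i, jetPartial i 0 f * MvPolynomial.X (i, 0) +
    MvPolynomial.mkDerivation (Smooth U)
      (fun v : Fin N × ℕ => (MvPolynomial.X (v.1, v.2 + 1) : DiffPoly U)) f
  map_zero' := by
    have h : ∀ i : Fin N, jetPartial i 0 (0 : DiffPoly U) = 0 := by
      intro i; ext m; simp [jetPartial]
    simp [h]
  map_add' f g := by
    have h : ∀ i : Fin N, jetPartial i 0 (f + g) = jetPartial i 0 f + jetPartial i 0 g := by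
      intro i; ext m; simp [jetPartial]
    simp only [h, add_mul, Finset.sum_add_distrib, map_add]
    exact add_add_add_comm _ _ _ _

/-- Formal power series in the dispersive parameter `ε` with differential polynomial coefficients. -/
abbrev EpsDiffPoly {N : ℕ} (U : TopologicalSpace.Opens (Fin N → ℝ)) : Type :=
  PowerSeries (DiffPoly U)

/-- The total derivative, coefficientwise in `ε`. -/
def epsTotalDeriv {N : ℕ} {U : TopologicalSpace.Opens (Fin N → ℝ)} (F : EpsDiffPoly U) :
    EpsDiffPoly U :=
  PowerSeries.mk fun n => totalDeriv (PowerSeries.coeff n F)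

/-! ### Formal pseudo-differential operators

A formal pseudo-differential operator `∑_{k ≤ m} a_k ∂_x^k` is realised by its action on formal
symbols, that is, on Laurent series `f` in `z = ξ⁻¹` with differential polynomial coefficients,
where `f` stands for `f e^{xξ}`: a differential polynomial acts by multiplication, `∂_x` acts as
`f ↦ ∂_x f + ξ f`, and `∂_x⁻¹` is the inverse of the latter map (which is bijective).  The operator
is recovered from its value `∑ a_k ξ^k` at the symbol `1`, so that an identity between
pseudo-differential operators is the same as an identity between these endomorphisms. -/

/-- The ring in which pseudo-differential operators live; the product is composition. -/
def PsiDO {N : ℕ} (U : TopologicalSpace.Opens (Fin N → ℝ)) : Type :=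
  AddMonoid.End (LaurentSeries (DiffPoly U))

instance {N : ℕ} (U : TopologicalSpace.Opens (Fin N → ℝ)) : Ring (PsiDO U) :=
  inferInstanceAs (Ring (AddMonoid.End (LaurentSeries (DiffPoly U))))

/-- The action of an operator on symbols. -/
def PsiDO.apply {N : ℕ} {U : TopologicalSpace.Opens (Fin N → ℝ)} (L : PsiDO U) :
    LaurentSeries (DiffPoly U) →+ LaurentSeries (DiffPoly U) := L

theorem PsiDO.ext {N : ℕ} {U : TopologicalSpace.Opens (Fin N → ℝ)} {L M : PsiDO U}
    (h : ∀ f, L.apply f = M.apply f) : L = M := AddMonoidHom.ext h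

/-- The operator of multiplication by a differential polynomial. -/
def mulOp {N : ℕ} (U : TopologicalSpace.Opens (Fin N → ℝ)) : DiffPoly U →+* PsiDO U :=
  Module.toAddMonoidEnd (DiffPoly U) (LaurentSeries (DiffPoly U))

/-- The map `f ↦ ∂_x f + ξ f`; `ξ = z⁻¹` is the Laurent monomial of exponent `-1`. -/
def dEnd {N : ℕ} (U : TopologicalSpace.Opens (Fin N → ℝ)) :
    LaurentSeries (DiffPoly U) →+ LaurentSeries (DiffPoly U) where
  toFun f := HahnSeries.map f totalDeriv + HahnSeries.single (-1) 1 * f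
  map_zero' := by ext k; simp
  map_add' f g := by
    ext k
    simp only [mul_add, HahnSeries.coeff_add, HahnSeries.map_coeff, map_add]
    exact add_add_add_comm _ _ _ _

/-- The operator `∂_x`. -/
def dOp {N : ℕ} (U : TopologicalSpace.Opens (Fin N → ℝ)) : PsiDO U := dEnd U

theorem dEnd_coeff {N : ℕ} (U : TopologicalSpace.Opens (Fin N → ℝ)) (f : LaurentSeries (DiffPoly U))
    (k : ℤ) : (dEnd U f).coeff k = totalDeriv (f.coeff k) + f.coeff (k + 1) := by
  change (HahnSeries.map f totalDeriv + HahnSeries.single (-1) 1 * f).coeff k = _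
  have h := HahnSeries.coeff_single_mul_add (r := (1 : DiffPoly U)) (x := f) (a := k + 1) (b := -1)
  rw [HahnSeries.coeff_add, HahnSeries.map_coeff]
  congr 1
  rw [one_mul, add_neg_cancel_right] at h
  exact h

/-- `∂_x` is invertible. -/
theorem isUnit_dOp {N : ℕ} (U : TopologicalSpace.Opens (Fin N → ℝ)) : IsUnit (dOp U) := by
  have hinj : Function.Injective (dEnd U) := by
    rw [injective_iff_map_eq_zero]
    intro f hf
    by_contra hne
    have h := dEnd_coeff U f (f.order - 1)
    have h0 : f.coeff (f.order - 1) = 0 := HahnSeries.coeff_eq_zero_of_lt_order (by omega)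
    rw [hf, h0, sub_add_cancel, HahnSeries.coeff_zero, map_zero, zero_add] at h
    exact HahnSeries.coeff_order_eq_zero.not.2 hne h.symm
  have hsurj : Function.Surjective (dEnd U) := by
    intro f
    let a : ℕ → DiffPoly U := fun n =>
      Nat.rec 0 (fun n p => f.coeff (f.order + n) - totalDeriv p) n
    have ha : ∀ n : ℕ, a (n + 1) = f.coeff (f.order + n) - totalDeriv (a n) := fun _ => rfl
    let g : ℤ → DiffPoly U := fun k => if f.order ≤ k then a (k - f.order).toNat else 0
    have hg : BddBelow (Function.support g) := by
      refine ⟨f.order, fun k hk => ?_⟩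
      by_contra h
      exact hk (if_neg h)
    refine ⟨HahnSeries.ofSuppBddBelow g hg, ?_⟩
    ext1
    funext k
    rw [dEnd_coeff]
    simp only [HahnSeries.coeff_ofSuppBddBelow]
    rcases lt_trichotomy (k + 1) f.order with h | h | h
    · have h1 : g k = 0 := if_neg (by omega)
      have h2 : g (k + 1) = 0 := if_neg (by omega)
      rw [h1, h2, HahnSeries.coeff_eq_zero_of_lt_order (by omega)]
      simp
    · have h1 : g k = 0 := if_neg (by omega)
      have h2 : g (k + 1) = 0 := by
        have h3 : g (k + 1) = a (k + 1 - f.order).toNat := if_pos (by omega)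
        rw [h3, h, sub_self]; rfl
      rw [h1, h2, HahnSeries.coeff_eq_zero_of_lt_order (by omega)]
      simp
    · obtain ⟨n, hn⟩ : ∃ n : ℕ, k = f.order + n := ⟨(k - f.order).toNat, by omega⟩
      have h1 : g k = a n := by
        have h3 : g k = a (k - f.order).toNat := if_pos (by omega)
        have h4 : (k - f.order).toNat = n := by omega
        rw [h3, h4]
      have h2 : g (k + 1) = a (n + 1) := by
        have h3 : g (k + 1) = a (k + 1 - f.order).toNat := if_pos (by omega)
        have h4 : (k + 1 - f.order).toNat = n + 1 := by omega
        rw [h3, h4]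
      rw [h1, h2, ha, hn]
      exact add_sub_cancel _ _
  let e : LaurentSeries (DiffPoly U) ≃+ LaurentSeries (DiffPoly U) :=
    AddEquiv.ofBijective (dEnd U) ⟨hinj, hsurj⟩
  refine ⟨⟨dOp U, e.symm.toAddMonoidHom, ?_, ?_⟩, rfl⟩
  · refine PsiDO.ext fun f => ?_
    exact e.apply_symm_apply f
  · refine PsiDO.ext fun f => ?_
    exact e.symm_apply_apply f

/-- The operator `∂_x⁻¹`: the two-sided inverse of `∂_x`. -/
def dInvOp {N : ℕ} (U : TopologicalSpace.Opens (Fin N → ℝ)) : PsiDO U := Ring.inverse (dOp U)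

theorem dOp_mul_dInvOp {N : ℕ} (U : TopologicalSpace.Opens (Fin N → ℝ)) :
    dOp U * dInvOp U = 1 := Ring.mul_inverse_cancel _ (isUnit_dOp U)

theorem dInvOp_mul_dOp {N : ℕ} (U : TopologicalSpace.Opens (Fin N → ℝ)) :
    dInvOp U * dOp U = 1 := Ring.inverse_mul_cancel _ (isUnit_dOp U)

/-- Formal power series in `ε` of pseudo-differential operators. -/
abbrev EpsPsiDO {N : ℕ} (U : TopologicalSpace.Opens (Fin N → ℝ)) : Type := PowerSeries (PsiDO U)

/-- Multiplication by an element of `𝒜[[ε]]`. -/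
def epsMulOp {N : ℕ} (U : TopologicalSpace.Opens (Fin N → ℝ)) : EpsDiffPoly U →+* EpsPsiDO U :=
  PowerSeries.map (mulOp U)

/-- `∂_x` among the `ε`-dependent operators. -/
def epsD {N : ℕ} (U : TopologicalSpace.Opens (Fin N → ℝ)) : EpsPsiDO U := PowerSeries.C (dOp U)

/-- `∂_x⁻¹` among the `ε`-dependent operators. -/
def epsDInv {N : ℕ} (U : TopologicalSpace.Opens (Fin N → ℝ)) : EpsPsiDO U :=
  PowerSeries.C (dInvOp U)

/-- The sum `∑_{n ≥ 0} ε^n L_n` of `ε`-dependent operators `L_n` (coefficientwise a finite sum). -/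
def epsSum {N : ℕ} {U : TopologicalSpace.Opens (Fin N → ℝ)} (L : ℕ → EpsPsiDO U) : EpsPsiDO U :=
  PowerSeries.mk fun m => ∑ n ∈ Finset.range (m + 1), PowerSeries.coeff (m - n) (L n)

/-- The Fréchet derivative `(ℓ_F)_i = ∑_σ (∂F/∂u^{i,σ}) ∂_x^σ`.  In each order in `ε` the sum is
finite, since a differential polynomial involves finitely many jet variables. -/
def frechet {N : ℕ} {U : TopologicalSpace.Opens (Fin N → ℝ)} (F : EpsDiffPoly U) (i : Fin N) :
    EpsPsiDO U :=
  PowerSeries.mk fun n =>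
    ∑ᶠ s : ℕ, mulOp U (jetPartial i s (PowerSeries.coeff n F)) * dOp U ^ s

/-- The formal adjoint `(ℓ_F^*)_i = ∑_σ (-∂_x)^σ ∘ (∂F/∂u^{i,σ})`. -/
def frechetAdj {N : ℕ} {U : TopologicalSpace.Opens (Fin N → ℝ)} (F : EpsDiffPoly U) (i : Fin N) :
    EpsPsiDO U :=
  PowerSeries.mk fun n =>
    ∑ᶠ s : ℕ, (-dOp U) ^ s * mulOp U (jetPartial i s (PowerSeries.coeff n F))

/-! ### Weakly non-local bivectors of localizable shape -/

/-- The coefficients of a weakly non-local bivector of localizable shape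
`∑_{d ≥ 1} ε^{d-1} (∑_{s=0}^d P^{ij}_{d,d-s} ∂_x^s + u^{i,1} ∂_x⁻¹ V_d^j + V_d^i ∂_x⁻¹ u^{j,1})`
with skew-symmetric local part.  Here `loc d s i j` is `P^{ij}_{d+1,d+1-s}`, the coefficient of
`∂_x^s` at `ε^d`, and `tail d i` is `V^i_{d+1}`.  (The non-local part is skew-symmetric
automatically.) -/
structure LocalizableBivector {N : ℕ} (U : TopologicalSpace.Opens (Fin N → ℝ)) where
  loc : ℕ → ℕ → Fin N → Fin N → DiffPoly U
  tail : ℕ → Fin N → DiffPoly U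
  loc_degree : ∀ d s i j, s ≤ d + 1 → HasDegree (loc d s i j) (d + 1 - s)
  tail_degree : ∀ d i, HasDegree (tail d i) (d + 1)
  loc_skew : ∀ d i j,
    ∑ s ∈ Finset.range (d + 2), (-dOp U) ^ s * mulOp U (loc d s i j) =
      -∑ s ∈ Finset.range (d + 2), mulOp U (loc d s j i) * dOp U ^ s

/-- The operator with the coefficients `P`, where the differential polynomials in the coordinates of
`W` are read as elements of `𝒜_U[[ε]]` through `φ`, and the derivation and its inverse are the
operators `D` and `Dinv` over `U`. -/
def LocalizableBivector.realize {N : ℕ} {U W : TopologicalSpace.Opens (Fin N → ℝ)}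
    (P : LocalizableBivector W) (φ : DiffPoly W → EpsDiffPoly U) (D Dinv : EpsPsiDO U) :
    Matrix (Fin N) (Fin N) (EpsPsiDO U) :=
  Matrix.of fun i j => epsSum fun d =>
    ∑ s ∈ Finset.range (d + 2), epsMulOp U (φ (P.loc d s i j)) * D ^ s +
      epsMulOp U (φ (MvPolynomial.X (i, 0))) * Dinv * epsMulOp U (φ (P.tail d j)) +
      epsMulOp U (φ (P.tail d i)) * Dinv * epsMulOp U (φ (MvPolynomial.X (j, 0)))

/-- The operator `P^{ij}` in its own coordinates `(x, u)`. -/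
def LocalizableBivector.op {N : ℕ} {U : TopologicalSpace.Opens (Fin N → ℝ)}
    (P : LocalizableBivector U) : Matrix (Fin N) (Fin N) (EpsPsiDO U) :=
  P.realize (fun f => PowerSeries.C f) (epsD U) (epsDInv U)

/-! ### Miura-reciprocal transformations -/

/-- A Miura-reciprocal transformation `dy = (∑_k ε^k H_k) dx`, `w^i = ∑_k ε^k K^i_k` from the
coordinates `u ∈ U` to the coordinates `w ∈ W`, with `H_k, K^i_k ∈ 𝒜_k`, the function `H_0`
without zeros, and `u ↦ K_0(u)` a bijection from `U` onto `W` with non-degenerate Jacobian. -/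
structure Transformation {N : ℕ} (U W : TopologicalSpace.Opens (Fin N → ℝ)) where
  H : ℕ → DiffPoly U
  K : Fin N → ℕ → DiffPoly U
  H_degree : ∀ k, HasDegree (H k) k
  K_degree : ∀ i k, HasDegree (K i k) k
  H_ne_zero : ∀ x : U, (MvPolynomial.constantCoeff (H 0)).1 x ≠ 0
  K_det_ne_zero : ∀ x : U, (Matrix.of fun i k : Fin N =>
    (partialDeriv k (MvPolynomial.constantCoeff (K i 0))).1 x).det ≠ 0
  K_bijOn : Set.BijOn (fun (x : U) (i : Fin N) => (MvPolynomial.constantCoeff (K i 0)).1 x)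
    Set.univ W

namespace Transformation

variable {N : ℕ} {U W : TopologicalSpace.Opens (Fin N → ℝ)}

/-- `B = ∑_k ε^k H_k`. -/
def B (T : Transformation U W) : EpsDiffPoly U := PowerSeries.mk T.H

/-- `Q^i = ∑_k ε^k K^i_k`. -/
def Q (T : Transformation U W) (i : Fin N) : EpsDiffPoly U := PowerSeries.mk (T.K i)

/-- The leading part `K^i_0` of `w^i`, as a function on `U`. -/
def K₀ (T : Transformation U W) (i : Fin N) : Smooth U := MvPolynomial.constantCoeff (T.K i 0)

theorem K₀_mem (T : Transformation U W) (x : U) : (fun i => (T.K₀ i).1 x) ∈ W :=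
  T.K_bijOn.mapsTo (Set.mem_univ x)

/-- `B` is invertible in `𝒜[[ε]]`. -/
theorem isUnit_B (T : Transformation U W) : IsUnit T.B := by
  rw [PowerSeries.isUnit_iff_constantCoeff]
  have h0 : PowerSeries.constantCoeff T.B = T.H 0 := by
    rw [← PowerSeries.coeff_zero_eq_constantCoeff_apply, B, PowerSeries.coeff_mk]
  have h1 : T.H 0 = MvPolynomial.C (MvPolynomial.constantCoeff (T.H 0)) := by
    ext1 m
    rw [MvPolynomial.coeff_C]
    split_ifs with hm
    · rw [← hm]; rfl
    · by_contra hne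
      have hw := T.H_degree 0 hne
      apply hm
      ext v
      have hle : m v • (v.2 + 1) ≤ Finsupp.weight (fun v : Fin N × ℕ => v.2 + 1) m := by
        rw [Finsupp.weight_apply, Finsupp.sum]
        by_cases hv : v ∈ m.support
        · exact Finset.single_le_sum (f := fun v : Fin N × ℕ => m v • (v.2 + 1))
            (fun _ _ => Nat.zero_le _) hv
        · rw [Finsupp.notMem_support_iff.1 hv]; simp
      rw [hw] at hle
      simp only [smul_eq_mul, Nat.le_zero, Nat.mul_eq_zero] at hle
      simp
      omega
  rw [h0, h1]
  refine IsUnit.map MvPolynomial.C ?_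
  set f : Smooth U := MvPolynomial.constantCoeff (T.H 0) with hf
  refine IsUnit.of_mul_eq_one ⟨fun x => (f.1 x)⁻¹, ?_⟩ ?_
  · have hinv : ContDiffOn ℝ ∞ (fun x => (extend f.1 x)⁻¹) U := by
      refine ContDiffOn.inv f.2 fun x hx => ?_
      have hx' : x ∈ U := hx
      simpa [extend, hx'] using T.H_ne_zero ⟨x, hx⟩
    exact hinv.congr (extend_eqOn _ _ fun x => by simp [extend])
  · refine Smooth.ext fun x => ?_
    exact mul_inv_cancel₀ (T.H_ne_zero x)

/-- `1/B`. -/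
def Binv (T : Transformation U W) : EpsDiffPoly U := Ring.inverse T.B

/-- The functions `w^{i,σ} = (B⁻¹ ∂_x)^σ Q^i`. -/
def jet (T : Transformation U W) (i : Fin N) : ℕ → EpsDiffPoly U
  | 0 => T.Q i
  | s + 1 => T.Binv * epsTotalDeriv (T.jet i s)

/-- The `n`-th Taylor term of `f(Q) = f(K_0 + h)`, `h = Q - K_0`, without the factor `1/n!`:
`∑_{i_1, …, i_n} (∂^n f/∂w^{i_1} ⋯ ∂w^{i_n})(K_0) h^{i_1} ⋯ h^{i_n}`. -/
def taylorTerm (T : Transformation U W) : ℕ → Smooth W → EpsDiffPoly U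
  | 0, f => PowerSeries.C (MvPolynomial.C (pullback T.K₀ T.K₀_mem f))
  | n + 1, f => ∑ i, T.taylorTerm n (partialDeriv i f) *
      (T.Q i - PowerSeries.C (MvPolynomial.C (T.K₀ i)))

/-- Substitution `f ↦ f(Q) ∈ 𝒜[[ε]]` for `f ∈ C^∞(W)`, by Taylor expansion at `K_0`.  As `h` is
divisible by `ε`, only the Taylor terms of order at most `m` contribute to the coefficient of
`ε^m`. -/
def substSmooth (T : Transformation U W) (f : Smooth W) : EpsDiffPoly U :=
  PowerSeries.mk fun m => ∑ n ∈ Finset.range (m + 1),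
    ((n.factorial : ℝ)⁻¹) • PowerSeries.coeff m (T.taylorTerm n f)

/-- Substitution of `w = Q`, `w^{i,σ} = (B⁻¹ ∂_x)^σ Q^i` in a differential polynomial on `W`. -/
def subst (T : Transformation U W) (f : DiffPoly W) : EpsDiffPoly U :=
  ∑ m ∈ f.support, T.substSmooth (MvPolynomial.coeff m f) *
    m.prod fun v k => T.jet v.1 (v.2 + 1) ^ k

/-- `∂_y = B⁻¹ ∂_x`. -/
def dY (T : Transformation U W) : EpsPsiDO U := epsMulOp U T.Binv * epsD U

/-- `∂_y⁻¹ = ∂_x⁻¹ ∘ B`. -/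
def dYInv (T : Transformation U W) : EpsPsiDO U := epsDInv U * epsMulOp U T.B

/-- The operators `𝒟^j_i = B (ℓ_{Q^j})_i - (∂_x Q^j) ∂_x⁻¹ (ℓ_B)_i`; row `j`, column `i`. -/
def calD (T : Transformation U W) : Matrix (Fin N) (Fin N) (EpsPsiDO U) :=
  Matrix.of fun j i => epsMulOp U T.B * frechet (T.Q j) i -
    epsMulOp U (epsTotalDeriv (T.Q j)) * epsDInv U * frechet T.B i

/-- The formal adjoints `(𝒟^*)^j_i = (ℓ_{Q^j}^*)_i B + (ℓ_B^*)_i ∂_x⁻¹ (∂_x Q^j)`; row `i`,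
column `j`. -/
def calDAdj (T : Transformation U W) : Matrix (Fin N) (Fin N) (EpsPsiDO U) :=
  Matrix.of fun i j => frechetAdj (T.Q j) i * epsMulOp U T.B +
    frechetAdj T.B i * epsDInv U * epsMulOp U (epsTotalDeriv (T.Q j))

/-- The action on bivectors.  Variational vector fields transform by `X ↦ B⁻¹ 𝒟(X)` and
covector-valued densities by `Ψ ↦ 𝒟^*(Ψ)` (from `(y, w)` to `(x, u)`), so a bivector, being a map
from the latter to the former, transforms by `P ↦ B⁻¹ 𝒟 ∘ P ∘ 𝒟^*`. -/
def act (T : Transformation U W) (P : Matrix (Fin N) (Fin N) (EpsPsiDO U)) :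
    Matrix (Fin N) (Fin N) (EpsPsiDO U) :=
  (Matrix.of fun h i => epsMulOp U T.Binv * T.calD h i) * P * T.calDAdj

end Transformation

/-- The operator of a bivector given in the coordinates `(y, w)`,
`∑_{d ≥ 1} ε^{d-1} (∑_{s=0}^d P^{ij}_{d,d-s} ∂_y^s + w^i_y ∂_y⁻¹ V_d^j + V_d^i ∂_y⁻¹ w^j_y)`,
read in the coordinates `(x, u)` through the transformation `T`. -/
def LocalizableBivector.opIn {N : ℕ} {U W : TopologicalSpace.Opens (Fin N → ℝ)}
    (P : LocalizableBivector W) (T : Transformation U W) :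
    Matrix (Fin N) (Fin N) (EpsPsiDO U) :=
  P.realize T.subst T.dY T.dYInv

end MiuraReciprocal

end

noncomputable section

namespace MiuraReciprocal

/-! ### Filtered rings of operators with an anti-involution -/

/-! Write `P = X - X*`, where `X^{ij} = Y^{ij} + u^{i,1} ∂⁻¹ V^j`, `Y` is half the local part and
`*` is the adjoint together with transposition. Then `𝒟 P 𝒟* = Z - Z*` for `Z = 𝒟 X 𝒟*`, so only the
non-local part of `Z` has to be controlled. Put `q^h = ∂_x Q^h`.

Since `∂^s ∘ u^{i,1} = u^{i,s+1} + (…)∂`, the operator `∑ ℓ_i ∘ u^{i,1}` of a series is its total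
derivative plus an operator divisible by `∂` on the right (`sum_frechetPair_mul`). With `∂⁻¹ B_x ∂⁻¹
= B ∂⁻¹ - ∂⁻¹ B`, the two terms `B q ∂⁻¹` in `𝒟 u_x ∂⁻¹` cancel, and what remains is local plus `q
∂⁻¹ (B - b)`. Dividing local operators by `∂` on both sides then gives `Z^{hk} = local + q^h ∂⁻¹ f^k
+ g^h ∂⁻¹ q^k + q^h ∂⁻¹ M ∂⁻¹ q^k` with `M` local. Skew-symmetrization removes the doubly non-local
term: `M - M* = L∂ + ∂L*`, so one of the two factors `∂⁻¹` disappears (`Shape.skew`). This is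
`transform_shape`. Multiplying by `B⁻¹` and using `∂⁻¹ = ∂_y⁻¹ B⁻¹` turns `q` into `w_y`.

The coefficients found in this way live over `U` and must be rewritten in the coordinates `(y, w)`.
To leading order in `ε`, the substitution maps `(𝒜_W)_d` onto `(𝒜_U)_d`: `K_0` is a diffeomorphism,
and the image is stable under `∂_x = H_0 ∂_y`. Successive approximation in `ε` lifts this to all
graded series and to all local operators (`exists_eq_epsSeries`). The adjoint for `dy` is `L ↦ B⁻¹
L* B`; on coefficients it is given by a universal formula, so skewness can be arranged over `W`
itself.

Operators are endomorphisms of symbols and carry no adjoint of their own. The computation therefore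
takes place in pairs (operator, adjoint), where the adjoint is the swap, and is projected to the
first component at the end. -/

/-- A ring `Ω` of operators over a differential ring `R`, with an invertible derivation `D`, a formal
adjoint `σ` and a grading `Loc` of the local operators. -/
structure AdjointCalculus (R Ω : Type*) [CommRing R] [Ring Ω] where
  m : R →+* Ω
  der : R → R
  D : Ω
  Di : Ω
  σ : Ω →+ Ω
  RG : ℤ → AddSubgroup R
  Loc : ℤ → AddSubgroup Ω
  comm : ∀ a, D * m a = m a * D + m (der a)
  D_mul_Di : D * Di = 1
  Di_mul_D : Di * D = 1
  σ_mul : ∀ x y, σ (x * y) = σ y * σ x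
  σ_σ : ∀ x, σ (σ x) = x
  σ_m : ∀ a, σ (m a) = m a
  σ_D : σ D = -D
  loc_mul : ∀ {i j x y}, x ∈ Loc i → y ∈ Loc j → x * y ∈ Loc (i + j)
  m_mem : ∀ {k a}, a ∈ RG k → m a ∈ Loc k
  σ_mem : ∀ {k x}, x ∈ Loc k → σ x ∈ Loc k
  right_div : ∀ {k x}, x ∈ Loc k → ∃ y ∈ Loc (k - 1), ∃ f ∈ RG k, x = y * D + m f

namespace AdjointCalculus

variable {R Ω : Type*} [CommRing R] [Ring Ω] (C : AdjointCalculus R Ω)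

theorem σ_one : C.σ 1 = 1 := by
  rw [← map_one C.m, C.σ_m]

theorem σ_Di : C.σ C.Di = -C.Di := by
  have h : C.σ C.Di * C.D = -1 := by
    have := congrArg C.σ C.D_mul_Di
    rw [C.σ_mul, C.σ_D, C.σ_one, mul_neg] at this
    rw [← this, neg_neg]
  calc C.σ C.Di = C.σ C.Di * C.D * C.Di := by rw [mul_assoc, C.D_mul_Di, mul_one]
    _ = -C.Di := by rw [h, neg_one_mul]

/-- Right division of the adjoint, read backwards; the sign of `σ D` is absorbed in the quotient. -/
theorem left_div {k : ℤ} {x : Ω} (hx : x ∈ C.Loc k) :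
    ∃ y ∈ C.Loc (k - 1), ∃ f ∈ C.RG k, x = C.D * y + C.m f := by
  obtain ⟨y, hy, f, hf, h⟩ := C.right_div (C.σ_mem hx)
  refine ⟨-C.σ y, neg_mem (C.σ_mem hy), f, hf, ?_⟩
  have := congrArg C.σ h
  rw [C.σ_σ, map_add, C.σ_mul, C.σ_D, C.σ_m] at this
  rw [this, neg_mul, mul_neg]

theorem mul_mem_loc {i j k : ℤ} {x y : Ω} (hx : x ∈ C.Loc i) (hy : y ∈ C.Loc j) (h : i + j = k) :
    x * y ∈ C.Loc k := h ▸ C.loc_mul hx hy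

theorem right_div_Di {k : ℤ} {x : Ω} (hx : x ∈ C.Loc k) :
    ∃ y ∈ C.Loc (k - 1), ∃ f ∈ C.RG k, x * C.Di = y + C.m f * C.Di := by
  obtain ⟨y, hy, f, hf, rfl⟩ := C.right_div hx
  exact ⟨y, hy, f, hf, by rw [add_mul, mul_assoc, C.D_mul_Di, mul_one]⟩

theorem left_div_Di {k : ℤ} {x : Ω} (hx : x ∈ C.Loc k) :
    ∃ y ∈ C.Loc (k - 1), ∃ f ∈ C.RG k, C.Di * x = y + C.Di * C.m f := by
  obtain ⟨y, hy, f, hf, rfl⟩ := C.left_div hx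
  exact ⟨y, hy, f, hf, by rw [mul_add, ← mul_assoc, C.Di_mul_D, one_mul]⟩

/-! ### Matrices of operators whose non-local part is governed by one vector -/

variable {ι : Type*}

/-- Matrices whose non-local part only involves the vector `q` at the outer ends. -/
def Shape (q : ι → R) (Z : ι → ι → Ω) : Prop :=
  ∃ (Λ : ι → ι → Ω) (f g : ι → R) (M : Ω), (∀ h k, Λ h k ∈ C.Loc 1) ∧ (∀ k, f k ∈ C.RG 1) ∧
    (∀ k, g k ∈ C.RG 1) ∧ M ∈ C.Loc 1 ∧ ∀ h k, Z h k = Λ h k + C.m (q h) * C.Di * C.m (f k) +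
      C.m (g h) * C.Di * C.m (q k) + C.m (q h) * C.Di * M * C.Di * C.m (q k)

theorem Shape.zero (q : ι → R) : C.Shape q fun _ _ => 0 :=
  ⟨fun _ _ => 0, fun _ => 0, fun _ => 0, 0, fun _ _ => zero_mem _, fun _ => zero_mem _,
    fun _ => zero_mem _, zero_mem _, fun h k => by simp⟩

variable {C} in
theorem Shape.add {q : ι → R} {Z Z' : ι → ι → Ω} (hZ : C.Shape q Z) (hZ' : C.Shape q Z') :
    C.Shape q fun h k => Z h k + Z' h k := by
  obtain ⟨Λ, f, g, M, hΛ, hf, hg, hM, h⟩ := hZ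
  obtain ⟨Λ', f', g', M', hΛ', hf', hg', hM', h'⟩ := hZ'
  refine ⟨fun h k => Λ h k + Λ' h k, fun k => f k + f' k, fun k => g k + g' k, M + M',
    fun h k => add_mem (hΛ h k) (hΛ' h k), fun k => add_mem (hf k) (hf' k),
    fun k => add_mem (hg k) (hg' k), add_mem hM hM', fun i j => ?_⟩
  simp only [h, h', map_add, mul_add, add_mul]
  abel

variable {C} in
theorem Shape.sum {α : Type*} {q : ι → R} (s : Finset α) {Z : α → ι → ι → Ω}
    (hZ : ∀ a, C.Shape q (Z a)) : C.Shape q fun h k => ∑ a ∈ s, Z a h k := by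
  classical
  induction s using Finset.induction_on with
  | empty => simpa using Shape.zero C q
  | insert a s ha ih => simpa [Finset.sum_insert ha] using (hZ a).add ih

/-- Of the four products, the two with a single `∂⁻¹` have it at the end of a local operator;
division by `∂` leaves only a function next to it. In the fourth product `c z` is enclosed between
two factors `∂⁻¹` and is kept as the operator `M` of the shape. -/
theorem shape_mul {q : ι → R} (hq : ∀ h, q h ∈ C.RG 1) {i j : ℤ} (hij : i + j = 1)
    {a y : ι → Ω} {c z : Ω} (ha : ∀ h, a h ∈ C.Loc i) (hc : c ∈ C.Loc i)
    (hy : ∀ k, y k ∈ C.Loc j) (hz : z ∈ C.Loc j) :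
    C.Shape q fun h k =>
      (a h + C.m (q h) * C.Di * c) * (y k + z * C.Di * C.m (q k)) := by
  choose R1 hR1 f1 hf1 h1 using fun h => C.right_div_Di (C.mul_mem_loc (ha h) hz hij)
  choose L1 hL1 f2 hf2 h2 using fun k => C.left_div_Di (C.mul_mem_loc hc (hy k) hij)
  refine ⟨fun h k => a h * y k + R1 h * C.m (q k) + C.m (q h) * L1 k, f2, f1, c * z, fun h k => ?_,
    hf2, hf1, C.mul_mem_loc hc hz hij, fun h k => ?_⟩ <;> beta_reduce
  · refine add_mem (add_mem (C.mul_mem_loc (ha h) (hy k) hij) ?_) ?_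
    · exact C.mul_mem_loc (hR1 h) (C.m_mem (hq k)) (by norm_num)
    · exact C.mul_mem_loc (C.m_mem (hq h)) (hL1 k) (by norm_num)
  · have e1 : a h * z * C.Di * C.m (q k) = R1 h * C.m (q k) + C.m (f1 h) * C.Di * C.m (q k) := by
      rw [h1, add_mul]
    have e2 : C.m (q h) * (C.Di * (c * y k)) =
        C.m (q h) * L1 k + C.m (q h) * C.Di * C.m (f2 k) := by
      rw [h2, mul_add, mul_assoc (C.m (q h))]
    calc _ = a h * y k + a h * z * C.Di * C.m (q k) + C.m (q h) * (C.Di * (c * y k)) +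
          C.m (q h) * C.Di * (c * z) * C.Di * C.m (q k) := by noncomm_ring
      _ = _ := by rw [e1, e2]; abel

/-- The skew-symmetrization of a matrix of the given shape is of localizable shape. -/
theorem Shape.skew {q : ι → R} (hq : ∀ h, q h ∈ C.RG 1) {Z : ι → ι → Ω} (hZ : C.Shape q Z) :
    ∃ (Λ : ι → ι → Ω) (F : ι → R), (∀ h k, Λ h k ∈ C.Loc 1) ∧ (∀ k, F k ∈ C.RG 1) ∧
      ∀ h k, Z h k - C.σ (Z k h) = Λ h k - C.σ (Λ k h) + C.m (q h) * C.Di * C.m (F k) +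
        C.m (F h) * C.Di * C.m (q k) := by
  obtain ⟨Λ, f, g, M, hΛ, hf, hg, hM, h⟩ := hZ
  -- The remainder `e` is a function, hence self-adjoint, and drops out of `M - σ M`; only the
  -- quotient `L` matters.
  obtain ⟨L, hL, e, -, hLe⟩ := C.right_div hM
  choose T hT t ht hTt using fun k =>
    C.left_div_Di (C.mul_mem_loc hL (C.m_mem (hq k)) (by norm_num : (1 - 1 : ℤ) + 1 = 1))
  have hM' : C.Di * (M - C.σ M) * C.Di = C.Di * L + C.σ L * C.Di := by
    have : M - C.σ M = L * C.D + C.D * C.σ L := by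
      rw [hLe, map_add, C.σ_mul, C.σ_D, C.σ_m]
      noncomm_ring
    rw [this, mul_add, add_mul, ← mul_assoc C.Di C.D, C.Di_mul_D, one_mul, ← mul_assoc C.Di L,
      mul_assoc (C.Di * L), C.D_mul_Di, mul_one]
  have hT' : ∀ k, C.m (q k) * C.σ L * C.Di = -C.σ (T k) + C.m (t k) * C.Di := by
    intro k
    have := congrArg C.σ (hTt k)
    simp only [map_add, C.σ_mul, C.σ_Di, C.σ_m] at this
    rw [mul_neg, neg_eq_iff_eq_neg] at this
    rw [this]
    noncomm_ring
  -- The adjoint exchanges the roles of `f` and `g`, so both enter the new tail; `T` and `t` come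
  -- from dividing `L ∘ q` by `∂` on the left.
  refine ⟨fun h k => Λ h k + C.m (q h) * T k, fun k => f k + g k + t k, fun h k => ?_,
    fun k => add_mem (add_mem (hf k) (hg k)) (ht k), fun i k => ?_⟩
  · exact add_mem (hΛ h k) (C.mul_mem_loc (C.m_mem (hq h)) (hT k) (by norm_num))
  · have e1 : C.m (q i) * C.Di * (M - C.σ M) * C.Di * C.m (q k) =
        C.m (q i) * T k - C.σ (T i) * C.m (q k) + C.m (q i) * C.Di * C.m (t k) +
        C.m (t i) * C.Di * C.m (q k) := by
      calc _ = C.m (q i) * (C.Di * (M - C.σ M) * C.Di) * C.m (q k) := by noncomm_ring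
        _ = C.m (q i) * (C.Di * (L * C.m (q k))) + C.m (q i) * C.σ L * C.Di * C.m (q k) := by
          rw [hM']; noncomm_ring
        _ = _ := by rw [hTt, hT']; noncomm_ring
    have e2 : C.m (q i) * C.Di * M * C.Di * C.m (q k) -
        C.m (q i) * C.Di * C.σ M * C.Di * C.m (q k) =
        C.m (q i) * T k - C.σ (T i) * C.m (q k) + C.m (q i) * C.Di * C.m (t k) +
        C.m (t i) * C.Di * C.m (q k) := by
      rw [← e1]; noncomm_ring
    rw [h, h]
    simp only [map_add, C.σ_mul, C.σ_Di, C.σ_m]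
    have e3 : C.m (q i) * (-C.Di * (C.σ M * (-C.Di * C.m (q k)))) =
        C.m (q i) * C.Di * C.σ M * C.Di * C.m (q k) := by noncomm_ring
    rw [e3]
    rw [sub_eq_iff_eq_add] at e2
    rw [e2]
    noncomm_ring

/-- The function `der b` is the commutator `[D, b]`, and each of its two terms cancels one of the
surrounding inverses. -/
theorem mul_der_mul_Di (b : R) :
    C.Di * C.m (C.der b) * C.Di = C.m b * C.Di - C.Di * C.m b := by
  have h : C.m (C.der b) = C.D * C.m b - C.m b * C.D := by rw [C.comm]; abel
  rw [h, mul_sub, sub_mul, ← mul_assoc, C.Di_mul_D, one_mul, mul_assoc, mul_assoc, C.D_mul_Di,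
    mul_one]

/-- The transform of a bivector of localizable shape, in terms of an abstract adjoint calculus. -/
theorem transform_shape [Fintype ι] {B : R} (hB : B ∈ C.RG 0) {q u V : ι → R}
    (hq : ∀ h, q h ∈ C.RG 1) (hV : ∀ h, V h ∈ C.RG 1)
    {l : ι → ι → Ω} {β : ι → Ω} (hl : ∀ h i, l h i ∈ C.Loc 0) (hβ : ∀ i, β i ∈ C.Loc 0)
    {Mq : ι → Ω} {Mb : Ω} (hMq : ∀ h, Mq h ∈ C.Loc 0) (hMb : Mb ∈ C.Loc 0)
    (hlu : ∀ h, ∑ i, l h i * C.m (u i) = C.m (q h) + Mq h * C.D)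
    (hβu : ∑ i, β i * C.m (u i) = C.m (C.der B) + Mb * C.D)
    {Y : ι → ι → Ω} (hY : ∀ i j, Y i j ∈ C.Loc 1) :
    ∃ (Λ : ι → ι → Ω) (F : ι → R), (∀ h k, Λ h k ∈ C.Loc 1) ∧ (∀ k, F k ∈ C.RG 1) ∧
      ∀ h k, ∑ i, ∑ j, (C.m B * l h i - C.m (q h) * C.Di * β i) *
          (Y i j + C.m (u i) * C.Di * C.m (V j) - C.σ (Y j i + C.m (u j) * C.Di * C.m (V i))) *
          C.σ (C.m B * l k j - C.m (q k) * C.Di * β j) =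
        Λ h k - C.σ (Λ k h) + C.m (q h) * C.Di * C.m (F k) + C.m (F h) * C.Di * C.m (q k) := by
  set 𝒟 : ι → ι → Ω := fun h i => C.m B * l h i - C.m (q h) * C.Di * β i with h𝒟
  have hσ𝒟 : ∀ k j, C.σ (𝒟 k j) = C.σ (l k j) * C.m B + C.σ (β j) * C.Di * C.m (q k) := by
    intro k j
    simp only [h𝒟, map_sub, C.σ_mul, C.σ_m, C.σ_Di]
    noncomm_ring
  set X : ι → ι → Ω := fun i j => Y i j + C.m (u i) * C.Di * C.m (V j) with hX
  obtain ⟨N, hN, b, hb, hNb⟩ := C.left_div_Di hMb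
  -- The decisive cancellation: `B q ∂⁻¹` arises from `B ℓ_Q` and again, with opposite sign, from `q
  -- ∂⁻¹ B_x ∂⁻¹`. The surviving non-local term has exactly `q` on its left.
  have hleft : ∀ h, ∑ i, 𝒟 h i * C.m (u i) * C.Di =
      (C.m B * Mq h - C.m (q h) * N) + C.m (q h) * C.Di * C.m (B - b) := by
    intro h
    have e : ∑ i, 𝒟 h i * C.m (u i) * C.Di = C.m B * (∑ i, l h i * C.m (u i)) * C.Di -
        C.m (q h) * C.Di * (∑ i, β i * C.m (u i)) * C.Di := by
      simp only [h𝒟, sub_mul, Finset.sum_sub_distrib, Finset.mul_sum, Finset.sum_mul, mul_assoc]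
    have hc : C.m B * C.m (q h) = C.m (q h) * C.m B := by rw [← map_mul, mul_comm, map_mul]
    rw [e, hlu, hβu]
    calc _ = C.m B * C.m (q h) * C.Di + C.m B * Mq h * (C.D * C.Di) -
          C.m (q h) * (C.Di * C.m (C.der B) * C.Di) -
          C.m (q h) * (C.Di * Mb) * (C.D * C.Di) := by noncomm_ring
      _ = _ := by
        rw [C.mul_der_mul_Di, hNb, C.D_mul_Di, hc, map_sub]
        noncomm_ring
  have hshape : C.Shape q fun h k => ∑ i, ∑ j, 𝒟 h i * X i j * C.σ (𝒟 k j) := by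
    -- Contribution of the local half `Y`: degree 1 on the left, degree 0 on the right.
    have h1 : C.Shape q fun h k => ∑ i, ∑ j,
        (C.m B * l h i * Y i j + C.m (q h) * C.Di * (-(β i * Y i j))) *
          (C.σ (l k j) * C.m B + C.σ (β j) * C.Di * C.m (q k)) := by
      refine Shape.sum _ fun i => Shape.sum _ fun j => ?_
      refine C.shape_mul (i := 1) (j := 0) hq (by norm_num) (fun h => ?_) (neg_mem ?_)
        (fun k => ?_) (C.σ_mem (hβ j))
      · exact C.mul_mem_loc (C.mul_mem_loc (C.m_mem hB) (hl h i) (add_zero 0)) (hY i j)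
          (by norm_num)
      · exact C.mul_mem_loc (hβ i) (hY i j) (by norm_num)
      · exact C.mul_mem_loc (C.σ_mem (hl k j)) (C.m_mem hB) (by norm_num)
    -- Contribution of `u ∂⁻¹ V`: the collapsed left factor has degree 0, and `V` supplies degree 1
    -- on the right.
    have h2 : C.Shape q fun h k =>
        ((C.m B * Mq h - C.m (q h) * N) + C.m (q h) * C.Di * C.m (B - b)) *
          ((∑ j, C.m (V j) * C.σ (l k j) * C.m B) +
            (∑ j, C.m (V j) * C.σ (β j)) * C.Di * C.m (q k)) := by
      refine C.shape_mul (i := 0) (j := 1) hq (by norm_num) (fun h => sub_mem ?_ ?_)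
        (C.m_mem (sub_mem hB hb)) (fun k => sum_mem fun j _ => ?_) (sum_mem fun j _ => ?_)
      · exact C.mul_mem_loc (C.m_mem hB) (hMq h) (by norm_num)
      · exact C.mul_mem_loc (C.m_mem (hq h)) hN (by norm_num)
      · exact C.mul_mem_loc (C.mul_mem_loc (C.m_mem (hV j)) (C.σ_mem (hl k j)) (add_zero 1))
          (C.m_mem hB) (by norm_num)
      · exact C.mul_mem_loc (C.m_mem (hV j)) (C.σ_mem (hβ j)) (by norm_num)
    convert h1.add h2 using 3 with h k
    rw [← hleft]
    have e2 : (∑ j, C.m (V j) * C.σ (l k j) * C.m B) +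
        (∑ j, C.m (V j) * C.σ (β j)) * C.Di * C.m (q k) = ∑ j, C.m (V j) * C.σ (𝒟 k j) := by
      simp only [hσ𝒟, mul_add, Finset.sum_add_distrib, Finset.sum_mul, mul_assoc]
    rw [e2, Finset.sum_mul_sum, ← Finset.sum_add_distrib]
    refine Finset.sum_congr rfl fun i _ => ?_
    rw [← Finset.sum_add_distrib]
    refine Finset.sum_congr rfl fun j _ => ?_
    rw [hσ𝒟]
    simp only [hX, h𝒟]
    noncomm_ring
  obtain ⟨Λ, F, hΛ, hF, h⟩ := hshape.skew C hq
  refine ⟨Λ, F, hΛ, hF, fun i k => ?_⟩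
  rw [← h]
  simp only [map_sum, C.σ_mul, C.σ_σ]
  rw [Finset.sum_comm (f := fun x x_1 => 𝒟 i x_1 * (C.σ (X x x_1) * C.σ (𝒟 k x))),
    ← Finset.sum_sub_distrib]
  refine Finset.sum_congr rfl fun a _ => ?_
  rw [← Finset.sum_sub_distrib]
  refine Finset.sum_congr rfl fun c _ => ?_
  change 𝒟 i a * (X a c - C.σ (X c a)) * C.σ (𝒟 k c) = _
  noncomm_ring

end AdjointCalculus

/-! ### Graded differential operators -/

/-- A grading of a differential ring by non-negative integers, written as a family over `ℤ`. -/
structure IsDiffGrading {A : Type*} [CommRing A] (der : A → A) (𝒜 : ℤ → AddSubgroup A) : Prop where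
  one_mem : 1 ∈ 𝒜 0
  mul_mem : ∀ {i j a b}, a ∈ 𝒜 i → b ∈ 𝒜 j → a * b ∈ 𝒜 (i + j)
  der_mem : ∀ {i a}, a ∈ 𝒜 i → der a ∈ 𝒜 (i + 1)
  eq_zero : ∀ {i a}, i < 0 → a ∈ 𝒜 i → a = 0

section OpGrade

variable {A E : Type*} [CommRing A] [Ring E]

/-- The span of the operators `a D^s` with `deg a + s = z`. -/
def opGrade (m : A →+* E) (D : E) (𝒜 : ℤ → AddSubgroup A) (z : ℤ) : AddSubgroup E :=
  AddSubgroup.closure {x | ∃ (r : ℤ) (s : ℕ) (a : A), a ∈ 𝒜 r ∧ r + s = z ∧ x = m a * D ^ s}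

variable {m : A →+* E} {D : E} {𝒜 : ℤ → AddSubgroup A} {der : A → A}

theorem mul_pow_mem_opGrade {r z : ℤ} {s : ℕ} {a : A} (ha : a ∈ 𝒜 r) (h : r + s = z) :
    m a * D ^ s ∈ opGrade m D 𝒜 z :=
  AddSubgroup.subset_closure ⟨r, s, a, ha, h, rfl⟩

theorem map_mem_opGrade {r : ℤ} {a : A} (ha : a ∈ 𝒜 r) : m a ∈ opGrade m D 𝒜 r := by
  simpa using mul_pow_mem_opGrade (m := m) (D := D) (s := 0) ha (add_zero r)

theorem D_mem_opGrade (h𝒜 : IsDiffGrading der 𝒜) : D ∈ opGrade m D 𝒜 1 := by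
  simpa using mul_pow_mem_opGrade (m := m) (D := D) (s := 1) h𝒜.one_mem (zero_add _)

theorem D_mul_mem_opGrade (h𝒜 : IsDiffGrading der 𝒜)
    (hc : ∀ a, D * m a = m a * D + m (der a)) {z : ℤ} {x : E} (hx : x ∈ opGrade m D 𝒜 z) :
    D * x ∈ opGrade m D 𝒜 (z + 1) := by
  induction hx using AddSubgroup.closure_induction with
  | mem x hx =>
    obtain ⟨r, s, a, ha, h, rfl⟩ := hx
    have e : D * (m a * D ^ s) = m a * D ^ (s + 1) + m (der a) * D ^ s := by
      rw [← mul_assoc, hc, add_mul, mul_assoc, ← pow_succ']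
    rw [e]
    exact add_mem (mul_pow_mem_opGrade ha (by push_cast; omega))
      (mul_pow_mem_opGrade (h𝒜.der_mem ha) (by omega))
  | zero => simp
  | add x y _ _ hx hy => rw [mul_add]; exact add_mem hx hy
  | neg x _ hx => rw [mul_neg]; exact neg_mem hx

theorem map_mul_mem_opGrade (h𝒜 : IsDiffGrading der 𝒜) {r z : ℤ} {a : A} {x : E} (ha : a ∈ 𝒜 r)
    (hx : x ∈ opGrade m D 𝒜 z) : m a * x ∈ opGrade m D 𝒜 (r + z) := by
  induction hx using AddSubgroup.closure_induction with
  | mem x hx =>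
    obtain ⟨r, s, a, ha, h, rfl⟩ := hx
    rw [← mul_assoc, ← map_mul]
    exact mul_pow_mem_opGrade (h𝒜.mul_mem ‹_› ha) (by omega)
  | zero => simp
  | add x y _ _ hx hy => rw [mul_add]; exact add_mem hx hy
  | neg x _ hx => rw [mul_neg]; exact neg_mem hx

/-- Moving `D` past a coefficient either keeps `D` or differentiates the coefficient; both raise the
total degree by one. -/
theorem mul_mem_opGrade (h𝒜 : IsDiffGrading der 𝒜)
    (hc : ∀ a, D * m a = m a * D + m (der a)) {i j : ℤ} {x y : E} (hx : x ∈ opGrade m D 𝒜 i)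
    (hy : y ∈ opGrade m D 𝒜 j) : x * y ∈ opGrade m D 𝒜 (i + j) := by
  induction hx using AddSubgroup.closure_induction with
  | mem x hx =>
    obtain ⟨r, s, a, ha, h, rfl⟩ := hx
    have hD : ∀ n : ℕ, D ^ n * y ∈ opGrade m D 𝒜 (n + j) := by
      intro n
      induction n with
      | zero => simpa using hy
      | succ n ih =>
        rw [pow_succ', mul_assoc]
        have := D_mul_mem_opGrade h𝒜 hc ih
        convert this using 1
        push_cast; ring_nf
    have := map_mul_mem_opGrade h𝒜 ha (hD s)
    rw [← h, mul_assoc, add_assoc]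
    exact this
  | zero => simp
  | add x y _ _ hx hy => rw [add_mul]; exact add_mem hx hy
  | neg x _ hx => rw [neg_mul]; exact neg_mem hx

theorem pow_mem_opGrade (h𝒜 : IsDiffGrading der 𝒜) (n : ℕ) : D ^ n ∈ opGrade m D 𝒜 n := by
  simpa using mul_pow_mem_opGrade (m := m) (D := D) (s := n) h𝒜.one_mem (zero_add _)

/-- Operators of degree `n` in normal form. -/
theorem exists_eq_sum_of_mem_opGrade (h𝒜 : IsDiffGrading der 𝒜) {n : ℕ} {x : E} (hx : x ∈ opGrade m D 𝒜 n) :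
    ∃ a : ℕ → A, (∀ s : ℕ, a s ∈ 𝒜 (n - s)) ∧ x = ∑ s ∈ Finset.range (n + 1), m (a s) * D ^ s := by
  induction hx using AddSubgroup.closure_induction with
  | mem x hx =>
    obtain ⟨r, s, a, ha, h, rfl⟩ := hx
    refine ⟨fun t => if t = s then a else 0, fun t => ?_, ?_⟩
    · dsimp only
      split_ifs with ht
      · rw [← h, ht, add_sub_cancel_right]; exact ha
      · exact zero_mem _
    · by_cases hs : s < n + 1
      · rw [Finset.sum_eq_single s (fun t _ ht => by simp [ht])
          (fun hs' => absurd (Finset.mem_range.2 hs) hs')]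
        simp
      -- A power of `D` beyond the total degree forces a coefficient of negative degree.
      · have : a = 0 := h𝒜.eq_zero (by omega) ha
        simp [this]
  | zero => exact ⟨fun _ => 0, fun _ => zero_mem _, by simp⟩
  | add x y _ _ hx hy =>
    obtain ⟨a, ha, rfl⟩ := hx
    obtain ⟨b, hb, rfl⟩ := hy
    exact ⟨fun s => a s + b s, fun s => add_mem (ha s) (hb s), by
      simp [add_mul, Finset.sum_add_distrib]⟩
  | neg x _ hx =>
    obtain ⟨a, ha, rfl⟩ := hx
    exact ⟨fun s => -a s, fun s => neg_mem (ha s), by simp⟩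

theorem right_div_opGrade {k : ℤ} {x : E} (hx : x ∈ opGrade m D 𝒜 k) :
    ∃ y ∈ opGrade m D 𝒜 (k - 1), ∃ f ∈ 𝒜 k, x = y * D + m f := by
  induction hx using AddSubgroup.closure_induction with
  | mem x hx =>
    obtain ⟨r, s, a, ha, h, rfl⟩ := hx
    cases s with
    | zero => exact ⟨0, zero_mem _, a, by simpa [← h] using ha, by simp⟩
    | succ s =>
      exact ⟨m a * D ^ s, mul_pow_mem_opGrade ha (by push_cast at h; omega), 0, zero_mem _, by
        simp [pow_succ, mul_assoc]⟩
  | zero => exact ⟨0, zero_mem _, 0, zero_mem _, by simp⟩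
  | add x y _ _ hx hy =>
    obtain ⟨a, ha, f, hf, rfl⟩ := hx
    obtain ⟨b, hb, g, hg, rfl⟩ := hy
    exact ⟨a + b, add_mem ha hb, f + g, add_mem hf hg, by simp [add_mul]; abel⟩
  | neg x _ hx =>
    obtain ⟨a, ha, f, hf, rfl⟩ := hx
    exact ⟨-a, neg_mem ha, -f, neg_mem hf, by simp [add_comm]⟩

end OpGrade

/-! ### The ring of operators together with their formal adjoints -/

section Pairs

variable {A E : Type*} [CommRing A] [Ring E]

/-- Multiplication by `a`, paired with its adjoint. -/
def pairMap (m : A →+* E) : A →+* E × Eᵐᵒᵖ :=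
  m.prod (m.toOpposite fun x y => by rw [Commute, SemiconjBy, ← map_mul, mul_comm, map_mul])

/-- The involution which exchanges an operator and its adjoint. -/
def pairSwap : E × Eᵐᵒᵖ →+ E × Eᵐᵒᵖ where
  toFun x := (x.2.unop, MulOpposite.op x.1)
  map_zero' := rfl
  map_add' _ _ := rfl

theorem pair_comm {m : A →+* E} {D : E} {der : A → A}
    (hc : ∀ a, D * m a = m a * D + m (der a)) (a : A) :
    ((D, MulOpposite.op (-D)) : E × Eᵐᵒᵖ) * pairMap m a =
      pairMap m a * (D, MulOpposite.op (-D)) + pairMap m (der a) := by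
  refine Prod.ext (hc a) (MulOpposite.unop_injective ?_)
  change m a * -D = -D * m a + m (der a)
  rw [neg_mul, hc]
  noncomm_ring

/-- The adjoint calculus of pairs of formally adjoint operators. -/
def pairCalculus (m : A →+* E) (D Di : E) (der : A → A) (𝒜 : ℤ → AddSubgroup A)
    (h𝒜 : IsDiffGrading der 𝒜) (hc : ∀ a, D * m a = m a * D + m (der a))
    (h1 : D * Di = 1) (h2 : Di * D = 1) : AdjointCalculus A (E × Eᵐᵒᵖ) where
  m := pairMap m
  der := der
  D := (D, MulOpposite.op (-D))
  Di := (Di, MulOpposite.op (-Di))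
  σ := pairSwap
  RG := 𝒜
  Loc := opGrade (pairMap m) (D, MulOpposite.op (-D)) 𝒜
  comm a := pair_comm hc a
  D_mul_Di := Prod.ext h1 (MulOpposite.unop_injective (by
    change -Di * -D = 1; rw [neg_mul_neg, h2]))
  Di_mul_D := Prod.ext h2 (MulOpposite.unop_injective (by
    change -D * -Di = 1; rw [neg_mul_neg, h1]))
  σ_mul _ _ := rfl
  σ_σ _ := rfl
  σ_m _ := rfl
  σ_D := Prod.ext rfl (MulOpposite.unop_injective (neg_neg D).symm)
  loc_mul hx hy := mul_mem_opGrade h𝒜 (pair_comm hc) hx hy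
  m_mem ha := map_mem_opGrade ha
  σ_mem {k x} hx := by
    induction hx using AddSubgroup.closure_induction with
    | mem x hx =>
      obtain ⟨r, s, a, ha, h, rfl⟩ := hx
      have e : pairSwap (pairMap m a * (D, MulOpposite.op (-D)) ^ s) =
          (-(D, MulOpposite.op (-D))) ^ s * pairMap m a := by
        have e1 : ∀ x y : E × Eᵐᵒᵖ, pairSwap (x * y) = pairSwap y * pairSwap x := fun _ _ => rfl
        have e2 : ∀ s : ℕ, pairSwap ((D, MulOpposite.op (-D)) ^ s) =
            (-(D, MulOpposite.op (-D))) ^ s := by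
          intro s
          induction s with
          | zero => rw [pow_zero, pow_zero]; rfl
          | succ s ih =>
            rw [pow_succ, e1, ih, pow_succ']
            congr 1
            exact Prod.ext rfl (MulOpposite.unop_injective (neg_neg D).symm)
        rw [e1, e2]; rfl
      -- The adjoint puts the coefficient to the right of the power of `D`; stability under products
      -- restores the normal order in the same degree. The sign is treated by cases, since the grade
      -- is only an additive subgroup.
      rw [e, neg_pow, mul_assoc, ← h, add_comm r]
      have := mul_mem_opGrade h𝒜 (pair_comm hc) (pow_mem_opGrade h𝒜 s)
        (map_mem_opGrade (m := pairMap m) (D := (D, MulOpposite.op (-D))) ha)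
      rcases neg_one_pow_eq_or (E × Eᵐᵒᵖ) s with h' | h' <;> rw [h']
      · simpa using this
      · simpa using neg_mem this
    | zero => simp
    | add x y _ _ hx hy => rw [map_add]; exact add_mem hx hy
    | neg x _ hx => rw [map_neg]; exact neg_mem hx
  right_div hx := right_div_opGrade hx

end Pairs

/-! ### Power series in `ε` -/

section Eps

variable {X : Type*} [Ring X]

/-- Power series whose coefficient of `ε^n` has degree `n + k`. -/
def epsGrade (𝒢 : ℤ → AddSubgroup X) (k : ℤ) : AddSubgroup (PowerSeries X) where
  carrier := {F | ∀ n : ℕ, PowerSeries.coeff n F ∈ 𝒢 (n + k)}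
  zero_mem' n := by simp
  add_mem' hx hy n := by rw [map_add]; exact add_mem (hx n) (hy n)
  neg_mem' hx n := by rw [map_neg]; exact neg_mem (hx n)

theorem mul_mem_epsGrade {𝒢 : ℤ → AddSubgroup X}
    (h𝒢 : ∀ {i j x y}, x ∈ 𝒢 i → y ∈ 𝒢 j → x * y ∈ 𝒢 (i + j)) {i j : ℤ} {x y : PowerSeries X}
    (hx : x ∈ epsGrade 𝒢 i) (hy : y ∈ epsGrade 𝒢 j) : x * y ∈ epsGrade 𝒢 (i + j) := by
  intro n
  rw [PowerSeries.coeff_mul]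
  refine sum_mem fun p hp => ?_
  have := h𝒢 (hx p.1) (hy p.2)
  have hn : p.1 + p.2 = n := Finset.HasAntidiagonal.mem_antidiagonal.1 hp
  convert this using 1
  rw [← hn]
  push_cast
  ring_nf

theorem C_mem_epsGrade {𝒢 : ℤ → AddSubgroup X} {k : ℤ} {x : X} (hx : x ∈ 𝒢 k) :
    PowerSeries.C x ∈ epsGrade 𝒢 k := by
  intro n
  rw [PowerSeries.coeff_C]
  split_ifs with h
  · simpa [h] using hx
  · exact zero_mem _

/-- An additive map applied to the coefficients of a power series. -/
def epsMap {Y : Type*} [Ring Y] (f : X →+ Y) : PowerSeries X →+ PowerSeries Y where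
  toFun F := PowerSeries.mk fun n => f (PowerSeries.coeff n F)
  map_zero' := by ext; simp
  map_add' F G := by ext; simp

@[simp]
theorem coeff_epsMap {Y : Type*} [Ring Y] (f : X →+ Y) (n : ℕ) (F : PowerSeries X) :
    PowerSeries.coeff n (epsMap f F) = f (PowerSeries.coeff n F) := by simp [epsMap]

theorem epsMap_C {Y : Type*} [Ring Y] (f : X →+ Y) (x : X) :
    epsMap f (PowerSeries.C x) = PowerSeries.C (f x) := by
  ext n
  rw [coeff_epsMap, PowerSeries.coeff_C, PowerSeries.coeff_C, apply_ite f, map_zero]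

/-- The sum `∑ ε^n L_n`. -/
def epsSeries (L : ℕ → PowerSeries X) : PowerSeries X :=
  PowerSeries.mk fun m => ∑ n ∈ Finset.range (m + 1), PowerSeries.coeff (m - n) (L n)

theorem coeff_epsSeries (L : ℕ → PowerSeries X) (m : ℕ) : PowerSeries.coeff m (epsSeries L) =
    ∑ n ∈ Finset.range (m + 1), PowerSeries.coeff (m - n) (L n) := PowerSeries.coeff_mk _ _

/-- Replaces the series by a genuine finite sum of terms `ε^n L_n`, of any sufficient length. One
common length can then be used for all coefficients that occur in a product. -/
theorem coeff_epsSeries_of_lt (L : ℕ → PowerSeries X) {m M : ℕ} (h : m < M) :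
    PowerSeries.coeff m (epsSeries L) =
      ∑ n ∈ Finset.range M, PowerSeries.coeff m (PowerSeries.X ^ n * L n) := by
  simp only [PowerSeries.coeff_X_pow_mul']
  rw [← Finset.sum_filter, coeff_epsSeries]
  refine Finset.sum_congr ?_ fun _ _ => rfl
  ext n
  simp only [Finset.mem_range, Finset.mem_filter]
  omega

theorem mul_epsSeries (c : PowerSeries X) (L : ℕ → PowerSeries X) :
    c * epsSeries L = epsSeries fun n => c * L n := by
  ext m
  rw [coeff_epsSeries_of_lt _ (Nat.lt_succ_self m), PowerSeries.coeff_mul]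
  have : ∀ n, PowerSeries.X ^ n * (c * L n) = c * (PowerSeries.X ^ n * L n) := fun n => by
    rw [← mul_assoc, ← mul_assoc, ((PowerSeries.commute_X c).pow_right n).eq]
  simp only [this, PowerSeries.coeff_mul _ c]
  rw [Finset.sum_comm]
  refine Finset.sum_congr rfl fun p hp => ?_
  have hn : p.1 + p.2 = m := Finset.HasAntidiagonal.mem_antidiagonal.1 hp
  rw [coeff_epsSeries_of_lt _ (show p.2 < m + 1 by omega), Finset.mul_sum]

theorem epsSeries_mul (c : PowerSeries X) (L : ℕ → PowerSeries X) :
    epsSeries L * c = epsSeries fun n => L n * c := by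
  ext m
  rw [coeff_epsSeries_of_lt _ (Nat.lt_succ_self m), PowerSeries.coeff_mul]
  simp only [← mul_assoc, PowerSeries.coeff_mul _ _ c]
  rw [Finset.sum_comm]
  refine Finset.sum_congr rfl fun p hp => ?_
  have hn : p.1 + p.2 = m := Finset.HasAntidiagonal.mem_antidiagonal.1 hp
  rw [coeff_epsSeries_of_lt _ (show p.1 < m + 1 by omega), Finset.sum_mul]

theorem epsSeries_add (L M : ℕ → PowerSeries X) :
    epsSeries (fun n => L n + M n) = epsSeries L + epsSeries M := by
  ext m
  simp [coeff_epsSeries, Finset.sum_add_distrib]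

theorem epsSeries_sub (L M : ℕ → PowerSeries X) :
    epsSeries (fun n => L n - M n) = epsSeries L - epsSeries M := by
  ext m
  simp [coeff_epsSeries, Finset.sum_sub_distrib]

theorem epsMap_epsSeries {Y : Type*} [Ring Y] (f : X →+ Y) (L : ℕ → PowerSeries X) :
    epsMap f (epsSeries L) = epsSeries fun n => epsMap f (L n) := by
  ext m
  simp [coeff_epsSeries]

theorem epsSeries_C (x : ℕ → X) : epsSeries (fun n => PowerSeries.C (x n)) = PowerSeries.mk x := by
  ext m
  rw [coeff_epsSeries, PowerSeries.coeff_mk, Finset.sum_eq_single m]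
  · simp
  · intro n hn hnm
    rw [PowerSeries.coeff_C, if_neg]
    have := Finset.mem_range.1 hn
    omega
  · simp

/-- If every element of degree `k` is the leading coefficient of a series of a given kind, then every
graded series is an `ε`-series of series of that kind. -/
theorem exists_eq_epsSeries {𝒢 : ℤ → AddSubgroup X} (S : ℕ → PowerSeries X → Prop)
    (hS : ∀ k y, S k y → y ∈ epsGrade 𝒢 k)
    (hlift : ∀ (k : ℕ), ∀ x ∈ 𝒢 k, ∃ y, S k y ∧ PowerSeries.constantCoeff y = x)
    {k : ℕ} {L : PowerSeries X} (hL : L ∈ epsGrade 𝒢 k) :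
    ∃ y : ℕ → PowerSeries X, (∀ n, S (k + n) (y n)) ∧ L = epsSeries y := by
  -- One step of successive approximation: subtract a lift of the leading coefficient and divide by
  -- `ε`. The division raises the degree by one, because the coefficient of `ε^(i+1)` becomes that
  -- of `ε^i`.
  have step : ∀ (n : ℕ) (F : epsGrade 𝒢 ((k + n : ℕ) : ℤ)),
      ∃ y, S (k + n) y ∧ ∃ G : epsGrade 𝒢 ((k + (n + 1) : ℕ) : ℤ),
        (F : PowerSeries X) = y + PowerSeries.X * (G : PowerSeries X) := by
    rintro n ⟨F, hF⟩
    obtain ⟨y, hy, hyF⟩ := hlift (k + n) (PowerSeries.coeff 0 F) (by simpa using hF 0)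
    have hd : F - y ∈ epsGrade 𝒢 ((k + n : ℕ) : ℤ) := sub_mem hF (hS _ _ hy)
    refine ⟨y, hy, ⟨PowerSeries.mk fun i => PowerSeries.coeff (i + 1) (F - y), fun i => ?_⟩, ?_⟩
    · rw [PowerSeries.coeff_mk]
      convert hd (i + 1) using 1
      push_cast
      ring_nf
    · have := PowerSeries.sub_const_eq_X_mul_shift (F - y)
      rw [map_sub, hyF] at this
      simp only [PowerSeries.coeff_zero_eq_constantCoeff, sub_self, map_zero, sub_zero] at this
      exact eq_add_of_sub_eq' this
  choose y hy G hG using step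
  -- The remainder after `n` steps, already divided by `ε^n`.
  let F : (n : ℕ) → epsGrade 𝒢 ((k + n : ℕ) : ℤ) := fun n =>
    Nat.rec (motive := fun n => epsGrade 𝒢 ((k + n : ℕ) : ℤ)) ⟨L, hL⟩ (fun n f => G n f) n
  have hF : ∀ n, (F n : PowerSeries X) = y n (F n) + PowerSeries.X * (F (n + 1) : PowerSeries X) :=
    fun n => hG n (F n)
  have hsum : ∀ M, L = ∑ n ∈ Finset.range M, PowerSeries.X ^ n * y n (F n) +
      PowerSeries.X ^ M * (F M : PowerSeries X) := by
    intro M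
    induction M with
    | zero => simp [F]
    | succ M ih =>
      rw [Finset.sum_range_succ, pow_succ, mul_assoc, add_assoc, ← mul_add, ← hF, ← ih]
  refine ⟨fun n => y n (F n), fun n => hy n _, ?_⟩
  ext m
  rw [coeff_epsSeries_of_lt _ (Nat.lt_succ_self m)]
  conv_lhs => rw [hsum (m + 1)]
  rw [map_add, map_sum, PowerSeries.coeff_X_pow_mul', if_neg (by omega), add_zero]

end Eps

/-- Power series over an adjoint calculus. -/
def AdjointCalculus.eps {A E : Type*} [CommRing A] [Ring E] (C : AdjointCalculus A E) :
    AdjointCalculus (PowerSeries A) (PowerSeries E) where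
  m := PowerSeries.map C.m
  der F := PowerSeries.mk fun n => C.der (PowerSeries.coeff n F)
  D := PowerSeries.C C.D
  Di := PowerSeries.C C.Di
  σ := epsMap C.σ
  RG := epsGrade C.RG
  Loc := epsGrade C.Loc
  comm F := by
    ext n
    simp [PowerSeries.coeff_C_mul, PowerSeries.coeff_mul_C, C.comm]
  D_mul_Di := by rw [← map_mul, C.D_mul_Di, map_one]
  Di_mul_D := by rw [← map_mul, C.Di_mul_D, map_one]
  σ_mul F G := by
    ext n
    rw [coeff_epsMap, PowerSeries.coeff_mul, PowerSeries.coeff_mul, map_sum,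
      ← Finset.Nat.sum_antidiagonal_swap]
    simp [C.σ_mul]
  σ_σ F := by ext n; simp [C.σ_σ]
  σ_m F := by ext n; simp [C.σ_m]
  σ_D := by rw [epsMap_C, C.σ_D, map_neg]
  loc_mul := mul_mem_epsGrade C.loc_mul
  m_mem hF n := by rw [PowerSeries.coeff_map]; exact C.m_mem (hF n)
  σ_mem hF n := by rw [coeff_epsMap]; exact C.σ_mem (hF n)
  right_div {k F} hF := by
    choose y hy f hf h using fun n => C.right_div (hF n)
    refine ⟨PowerSeries.mk y, fun n => ?_, PowerSeries.mk f, fun n => ?_, ?_⟩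
    · rw [PowerSeries.coeff_mk, ← add_sub_assoc]; exact hy n
    · rw [PowerSeries.coeff_mk]; exact hf n
    · ext n
      simp [PowerSeries.coeff_mul_C, h]

/-! ### Calculus on `C^∞(U)` -/

section Calculus

variable {N : ℕ} {U W : TopologicalSpace.Opens (Fin N → ℝ)}

theorem extend_apply (f : U → ℝ) (x : U) : extend f x = f x := by
  simp [extend]

theorem Smooth.contDiffAt (f : Smooth U) (x : U) : ContDiffAt ℝ ∞ (extend f.1) x :=
  ContDiffOn.contDiffAt f.2 (U.2.mem_nhds x.2)

theorem Smooth.differentiableAt (f : Smooth U) (x : U) :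
    DifferentiableAt ℝ (extend f.1) x :=
  (f.contDiffAt x).differentiableAt (by simp)

theorem partialDeriv_apply (i : Fin N) (f : Smooth U) (x : U) :
    (partialDeriv i f).1 x = fderiv ℝ (extend f.1) x (Pi.single i 1) := rfl

theorem eventuallyEq_of_eqOn {f g : (Fin N → ℝ) → ℝ} (h : Set.EqOn f g U) (x : U) :
    f =ᶠ[nhds (x : Fin N → ℝ)] g :=
  Set.EqOn.eventuallyEq_of_mem h (U.2.mem_nhds x.2)

theorem partialDeriv_mul (i : Fin N) (f g : Smooth U) :
    partialDeriv i (f * g) = partialDeriv i f * g + f * partialDeriv i g := by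
  refine Smooth.ext fun x => ?_
  have h : extend (f * g).1 =ᶠ[nhds (x : Fin N → ℝ)] fun y => extend f.1 y * extend g.1 y :=
    eventuallyEq_of_eqOn (extend_eqOn _ _ fun y => by rw [extend_apply, extend_apply]; rfl) x
  rw [partialDeriv_apply, h.fderiv_eq, fderiv_fun_mul (f.differentiableAt x) (g.differentiableAt x)]
  change extend f.1 x * (partialDeriv i g).1 x + extend g.1 x * (partialDeriv i f).1 x =
    (partialDeriv i f).1 x * g.1 x + f.1 x * (partialDeriv i g).1 x
  rw [extend_apply, extend_apply]
  ring

theorem partialDeriv_comm (i j : Fin N) (f : Smooth U) :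
    partialDeriv i (partialDeriv j f) = partialDeriv j (partialDeriv i f) := by
  refine Smooth.ext fun x => ?_
  have key : ∀ a b : Fin N, (partialDeriv a (partialDeriv b f)).1 x =
      fderiv ℝ (fderiv ℝ (extend f.1)) x (Pi.single a 1) (Pi.single b 1) := by
    intro a b
    have h : extend (partialDeriv b f).1 =ᶠ[nhds (x : Fin N → ℝ)]
        fun y => fderiv ℝ (extend f.1) y (Pi.single b 1) :=
      eventuallyEq_of_eqOn (extend_eqOn (partialDeriv b f).1 _ fun _ => rfl) x
    have hd : DifferentiableAt ℝ (fderiv ℝ (extend f.1)) x :=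
      ((f.contDiffAt x).fderiv_right (m := ∞) (by simp)).differentiableAt (by simp)
    rw [partialDeriv_apply, h.fderiv_eq, fderiv_clm_apply hd (differentiableAt_const _)]
    simp
  rw [key, key]
  exact ((f.contDiffAt x).isSymmSndFDerivAt
    (by rw [minSmoothness_of_isRCLikeNormedField]; exact WithTop.coe_le_coe.2 le_top)).eq _ _

/-- The pull-back of smooth functions, as a ring homomorphism. -/
def pullbackHom (k : Fin N → Smooth U) (hk : ∀ x : U, (fun i => (k i).1 x) ∈ W) :
    Smooth W →+* Smooth U where
  toFun := pullback k hk
  map_one' := rfl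
  map_mul' _ _ := rfl
  map_zero' := rfl
  map_add' _ _ := rfl

theorem partialDeriv_pullback (k : Fin N → Smooth U) (hk : ∀ x : U, (fun i => (k i).1 x) ∈ W)
    (f : Smooth W) (j : Fin N) : partialDeriv j (pullback k hk f) =
      ∑ i, pullback k hk (partialDeriv i f) * partialDeriv j (k i) := by
  refine Smooth.ext fun x => ?_
  have hval : ∀ y : U, (fun i => extend (k i).1 y) = fun i => (k i).1 y :=
    fun y => funext fun i => extend_apply _ _
  have h : extend (pullback k hk f).1 =ᶠ[nhds (x : Fin N → ℝ)]
      (extend f.1 ∘ fun y i => extend (k i).1 y) :=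
    eventuallyEq_of_eqOn (extend_eqOn _ _ fun y => by
      simp only [Function.comp, hval y]
      exact (extend_apply f.1 ⟨_, hk y⟩).symm) x
  have hk' : HasFDerivAt (fun y i => extend (k i).1 y)
      (ContinuousLinearMap.pi fun i => fderiv ℝ (extend (k i).1) x) (x : Fin N → ℝ) :=
    hasFDerivAt_pi.2 fun i => ((k i).differentiableAt x).hasFDerivAt
  have hf : HasFDerivAt (extend f.1) (fderiv ℝ (extend f.1) (fun i => (k i).1 x))
      (fun i => extend (k i).1 x) := by
    rw [hval x]
    exact (f.differentiableAt ⟨_, hk x⟩).hasFDerivAt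
  rw [partialDeriv_apply, h.fderiv_eq, (hf.comp _ hk').fderiv, ContinuousLinearMap.comp_apply]
  -- The `j`-th column of the Jacobian, expanded in the standard basis.
  have hv : (ContinuousLinearMap.pi fun i => fderiv ℝ (extend (k i).1) x) (Pi.single j 1) =
      ∑ i, (partialDeriv j (k i)).1 x • (Pi.single i 1 : Fin N → ℝ) := by
    funext i
    simp [partialDeriv_apply, Finset.sum_apply, Pi.single_apply]
  rw [hv, map_sum]
  have hs : ∀ (s : Finset (Fin N)) (F : Fin N → Smooth U),
      (∑ i ∈ s, F i).1 x = ∑ i ∈ s, (F i).1 x := fun s F => by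
    induction s using Finset.induction_on with
    | empty => rfl
    | insert a s ha ih => rw [Finset.sum_insert ha, Finset.sum_insert ha, ← ih]; rfl
  rw [hs]
  refine Finset.sum_congr rfl fun i _ => ?_
  rw [map_smul, smul_eq_mul, mul_comm]
  rfl

/-- The coordinate function `u^i`. -/
def coord (U : TopologicalSpace.Opens (Fin N → ℝ)) (i : Fin N) : Smooth U :=
  ⟨fun x => (x : Fin N → ℝ) i, by
    have h : ContDiffOn ℝ ∞ (fun x : Fin N → ℝ => x i) U := (contDiff_apply ℝ ℝ i).contDiffOn
    exact h.congr (extend_eqOn _ _ fun _ => rfl)⟩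

theorem partialDeriv_one (j : Fin N) : partialDeriv j (1 : Smooth U) = 0 := by
  have h := partialDeriv_mul j (1 : Smooth U) 1
  simpa using h

theorem partialDeriv_coord (i j : Fin N) :
    partialDeriv j (coord U i) = if i = j then 1 else 0 := by
  refine Smooth.ext fun x => ?_
  have h : extend (coord U i).1 =ᶠ[nhds (x : Fin N → ℝ)]
      (ContinuousLinearMap.proj (R := ℝ) (φ := fun _ : Fin N => ℝ) i) :=
    eventuallyEq_of_eqOn (extend_eqOn (coord U i).1 _ fun _ => rfl) x
  rw [partialDeriv_apply, h.fderiv_eq, ContinuousLinearMap.fderiv, ContinuousLinearMap.proj_apply,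
    Pi.single_apply]
  split_ifs <;> rfl

/-- The substitution `u ↦ K_0(u)` identifies `C^∞(W)` with `C^∞(U)`. -/
theorem Transformation.pullback_surjective (T : Transformation U W) :
    Function.Surjective (pullbackHom T.K₀ T.K₀_mem) := by
  intro g
  have hbij := T.K_bijOn
  let κ : (Fin N → ℝ) → (Fin N → ℝ) := fun y i => extend (T.K₀ i).1 y
  have hκ : ∀ y : U, κ y = fun i => (T.K₀ i).1 y := fun y => funext fun i => extend_apply _ _
  -- The set-theoretic inverse of `K_0`; the preimage of `g` is `g ∘ ψ`, and its smoothness is what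
  -- has to be shown.
  choose ψ hψ using fun w : W => hbij.surjOn w.2
  have hψ' : ∀ w : W, (fun i => (T.K₀ i).1 (ψ w)) = w := fun w => (hψ w).2
  have hsm : ContDiffOn ℝ ∞ (extend fun w : W => g.1 (ψ w)) W := by
    intro w hw
    refine ContDiffAt.contDiffWithinAt ?_
    set x : U := ψ ⟨w, hw⟩ with hx
    have hxw : κ x = w := (hκ x).trans (hψ' ⟨w, hw⟩)
    have hκc : ContDiffAt ℝ ∞ κ x := contDiffAt_pi.2 fun i => (T.K₀ i).contDiffAt x
    have hκd : HasFDerivAt κ (ContinuousLinearMap.pi fun i => fderiv ℝ (extend (T.K₀ i).1) x)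
        (x : Fin N → ℝ) := hasFDerivAt_pi.2 fun i => ((T.K₀ i).differentiableAt x).hasFDerivAt
    set J : Matrix (Fin N) (Fin N) ℝ := Matrix.of fun i k => (partialDeriv k (T.K₀ i)).1 x with hJ
    have hJdet : IsUnit J.det := isUnit_iff_ne_zero.2 (T.K_det_ne_zero x)
    let e : (Fin N → ℝ) ≃L[ℝ] (Fin N → ℝ) :=
      (Matrix.toLinearEquiv' J ((Matrix.isUnit_iff_isUnit_det J).2 hJdet).invertible
        ).toContinuousLinearEquiv
    have he : (e : (Fin N → ℝ) →L[ℝ] (Fin N → ℝ)) =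
        ContinuousLinearMap.pi fun i => fderiv ℝ (extend (T.K₀ i).1) x := by
      refine ContinuousLinearMap.coe_injective (LinearMap.pi_ext' fun k => LinearMap.ext_ring ?_)
      funext i
      change (J.mulVec (Pi.single k 1)) i = fderiv ℝ (extend (T.K₀ i).1) x (Pi.single k 1)
      rw [Matrix.mulVec_single_one]
      rfl
    rw [← he] at hκd
    -- The inverse function theorem supplies a smooth local inverse; injectivity of `K_0` on all of
    -- `U` shows below that `ψ` agrees with it near `w`.
    let ρ := hκc.localInverse hκd (by simp)
    have hρc : ContDiffAt ℝ ∞ ρ w := by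
      have := hκc.to_localInverse hκd (by simp)
      rwa [hxw] at this
    have hρw : ρ w = x := by
      have := hκc.localInverse_apply_image hκd (by simp)
      rwa [hxw] at this
    have hright : ∀ᶠ v in nhds w, κ (ρ v) = v := by
      have := (hκc.hasStrictFDerivAt' hκd (by simp)).eventually_right_inverse
      rwa [hxw] at this
    have hmem : ∀ᶠ v in nhds w, ρ v ∈ U :=
      hρc.continuousAt.eventually_mem (by rw [hρw]; exact U.2.mem_nhds x.2)
    have hW : ∀ᶠ v in nhds w, v ∈ W := W.2.mem_nhds hw
    have hcomp : ContDiffAt ℝ ∞ (extend g.1 ∘ ρ) w := by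
      refine ContDiffAt.comp w ?_ hρc
      rw [hρw]
      exact g.contDiffAt x
    refine hcomp.congr_of_eventuallyEq ?_
    filter_upwards [hright, hmem, hW] with v h1 h2 h3
    have hψv : ψ ⟨v, h3⟩ = ⟨ρ v, h2⟩ := by
      refine hbij.injOn (Set.mem_univ _) (Set.mem_univ _) ?_
      refine (hψ' ⟨v, h3⟩).trans ?_
      change v = fun i => (T.K₀ i).1 ⟨ρ v, h2⟩
      rw [← hκ ⟨ρ v, h2⟩]
      exact h1.symm
    have h4 := extend_apply (fun w : W => g.1 (ψ w)) ⟨v, h3⟩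
    have h5 := extend_apply g.1 ⟨ρ v, h2⟩
    rw [Function.comp, h4, h5, hψv]
  refine ⟨⟨fun w => g.1 (ψ w), hsm⟩, Smooth.ext fun x => ?_⟩
  change g.1 (ψ ⟨fun i => (T.K₀ i).1 x, T.K₀_mem x⟩) = g.1 x
  exact congrArg g.1 (hbij.injOn (Set.mem_univ _) (Set.mem_univ _) (hψ' ⟨_, T.K₀_mem x⟩))

end Calculus

/-! ### The graded differential ring of differential polynomials -/

section DiffPolyCalculus

open MvPolynomial (X C coeff)

variable {N : ℕ} {U : TopologicalSpace.Opens (Fin N → ℝ)}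

theorem coeff_jetPartial_zero (i : Fin N) (f : DiffPoly U) (d : Fin N × ℕ →₀ ℕ) :
    coeff d (jetPartial i 0 f) = partialDeriv i (coeff d f) := rfl

theorem jetPartial_zero_mul (i : Fin N) (f g : DiffPoly U) :
    jetPartial i 0 (f * g) = jetPartial i 0 f * g + f * jetPartial i 0 g := by
  ext1 d
  rw [coeff_jetPartial_zero, MvPolynomial.coeff_add, MvPolynomial.coeff_mul,
    MvPolynomial.coeff_mul, MvPolynomial.coeff_mul, map_sum, ← Finset.sum_add_distrib]
  refine Finset.sum_congr rfl fun p _ => ?_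
  rw [partialDeriv_mul, coeff_jetPartial_zero, coeff_jetPartial_zero]

theorem jetPartial_zero_C (i : Fin N) (f : Smooth U) :
    jetPartial i 0 (C f : DiffPoly U) = C (partialDeriv i f) := by
  ext1 d
  rw [coeff_jetPartial_zero, MvPolynomial.coeff_C, MvPolynomial.coeff_C, apply_ite (partialDeriv i),
    map_zero]

theorem jetPartial_zero_X (i : Fin N) (v : Fin N × ℕ) :
    jetPartial i 0 (X v : DiffPoly U) = 0 := by
  ext1 d
  rw [coeff_jetPartial_zero, MvPolynomial.coeff_X, apply_ite (partialDeriv i), map_zero,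
    partialDeriv_one, MvPolynomial.coeff_zero, ite_self]

theorem totalDeriv_apply (f : DiffPoly U) :
    totalDeriv f = ∑ i, jetPartial i 0 f * X (i, 0) + MvPolynomial.mkDerivation (Smooth U)
      (fun v : Fin N × ℕ => (X (v.1, v.2 + 1) : DiffPoly U)) f := rfl

theorem totalDeriv_mul (f g : DiffPoly U) :
    totalDeriv (f * g) = totalDeriv f * g + f * totalDeriv g := by
  have h : ∑ i, jetPartial i 0 (f * g) * X (i, 0) =
      (∑ i, jetPartial i 0 f * X (i, 0)) * g + f * ∑ i, jetPartial i 0 g * X (i, 0) := by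
    rw [Finset.sum_mul, Finset.mul_sum, ← Finset.sum_add_distrib]
    refine Finset.sum_congr rfl fun i _ => ?_
    rw [jetPartial_zero_mul]
    ring
  rw [totalDeriv_apply, totalDeriv_apply, totalDeriv_apply, h, Derivation.leibniz, smul_eq_mul,
    smul_eq_mul]
  ring

theorem totalDeriv_X (v : Fin N × ℕ) :
    totalDeriv (X v : DiffPoly U) = X (v.1, v.2 + 1) := by
  rw [totalDeriv_apply, MvPolynomial.mkDerivation_X]
  simp [jetPartial_zero_X]

theorem totalDeriv_C (f : Smooth U) :
    totalDeriv (C f : DiffPoly U) = ∑ i, C (partialDeriv i f) * X (i, 0) := by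
  rw [totalDeriv_apply, MvPolynomial.derivation_C, add_zero]
  simp only [jetPartial_zero_C]

/-- The grading of the differential polynomials, indexed by `ℤ`. -/
def degGrade (U : TopologicalSpace.Opens (Fin N → ℝ)) (z : ℤ) : AddSubgroup (DiffPoly U) where
  carrier := {f | ∀ d, coeff d f ≠ 0 →
    ((Finsupp.weight (fun v : Fin N × ℕ => v.2 + 1) d : ℕ) : ℤ) = z}
  zero_mem' d hd := absurd (MvPolynomial.coeff_zero d) hd
  add_mem' {f g} hf hg d hd := by
    by_cases h : coeff d f = 0
    · exact hg d fun h' => hd (by rw [MvPolynomial.coeff_add, h, h', add_zero])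
    · exact hf d h
  neg_mem' {f} hf d hd := hf d fun h => hd (by rw [MvPolynomial.coeff_neg, h, neg_zero])

theorem mem_degGrade {z : ℤ} {f : DiffPoly U} : f ∈ degGrade U z ↔ ∀ d, coeff d f ≠ 0 →
    ((Finsupp.weight (fun v : Fin N × ℕ => v.2 + 1) d : ℕ) : ℤ) = z := Iff.rfl

theorem hasDegree_iff {f : DiffPoly U} {d : ℕ} : HasDegree f d ↔ f ∈ degGrade U d := by
  simp only [HasDegree, MvPolynomial.IsWeightedHomogeneous, mem_degGrade, Nat.cast_inj]

theorem mul_mem_degGrade {i j : ℤ} {f g : DiffPoly U} (hf : f ∈ degGrade U i)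
    (hg : g ∈ degGrade U j) : f * g ∈ degGrade U (i + j) := by
  intro d hd
  rw [MvPolynomial.coeff_mul] at hd
  obtain ⟨p, hp, hne⟩ := Finset.exists_ne_zero_of_sum_ne_zero hd
  rw [← hf p.1 (left_ne_zero_of_mul hne), ← hg p.2 (right_ne_zero_of_mul hne),
    ← Finset.HasAntidiagonal.mem_antidiagonal.1 hp, map_add, Nat.cast_add]

theorem C_mem_degGrade (f : Smooth U) : (C f : DiffPoly U) ∈ degGrade U 0 := by
  intro d hd
  rw [MvPolynomial.coeff_C] at hd
  have h : 0 = d := by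
    by_contra h
    exact hd (if_neg h)
  rw [← h]
  simp

theorem X_mem_degGrade (v : Fin N × ℕ) : (X v : DiffPoly U) ∈ degGrade U (v.2 + 1) := by
  intro d hd
  rw [MvPolynomial.coeff_X] at hd
  have h : Finsupp.single v 1 = d := by
    by_contra h
    exact hd (if_neg h)
  rw [← h]
  simp [Finsupp.weight_single]

theorem degGrade_eq_zero {i : ℤ} {f : DiffPoly U} (hi : i < 0) (hf : f ∈ degGrade U i) :
    f = 0 := by
  ext1 d
  by_contra h
  have := hf d h
  omega

/-- Homogeneous elements of degree zero are functions on `U`. -/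
theorem eq_C_of_mem_degGrade_zero {f : DiffPoly U} (hf : f ∈ degGrade U 0) :
    f = C (MvPolynomial.constantCoeff f) := by
  ext1 d
  rw [MvPolynomial.coeff_C]
  split_ifs with h
  · rw [← h]; rfl
  · by_contra hne
    have hw := hf d hne
    apply h
    ext v
    by_contra hv
    have hle : v.2 + 1 ≤ Finsupp.weight (fun v : Fin N × ℕ => v.2 + 1) d :=
      Finsupp.le_weight_of_ne_zero' (fun v : Fin N × ℕ => v.2 + 1) (fun h => hv h.symm)
    omega

theorem jetPartial_mem_degGrade {z : ℤ} {f : DiffPoly U} (hf : f ∈ degGrade U z) (i : Fin N)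
    (s : ℕ) : jetPartial i s f ∈ degGrade U (z - s) := by
  cases s with
  | zero =>
    intro d hd
    rw [coeff_jetPartial_zero] at hd
    rw [Nat.cast_zero, sub_zero]
    exact hf d fun h => hd (by rw [h, map_zero])
  | succ s =>
    intro d hd
    change coeff d (MvPolynomial.pderiv (i, s) f) ≠ 0 at hd
    rw [MvPolynomial.coeff_pderiv] at hd
    have := hf _ (left_ne_zero_of_mul hd)
    rw [map_add, Finsupp.weight_single] at this
    push_cast at this ⊢
    simp at this
    omega

theorem jetPartial_eq_zero_of_mem_degGrade {n : ℕ} {f : DiffPoly U} (hf : f ∈ degGrade U n)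
    (i : Fin N) {s : ℕ} (hs : n < s) : jetPartial i s f = 0 :=
  degGrade_eq_zero (by omega) (jetPartial_mem_degGrade hf i s)

theorem derivation_sum_apply {R A : Type*} [CommRing R] [CommRing A] [Algebra R A] {α : Type*}
    (s : Finset α) (D : α → Derivation R A A) (a : A) :
    (∑ i ∈ s, D i) a = ∑ i ∈ s, D i a := by
  classical
  induction s using Finset.induction_on with
  | empty => simp
  | insert i s hi ih => simp [Finset.sum_insert hi, ih]

/-- `∂_x f = ∑ u^{i,σ+1} ∂f/∂u^{i,σ}`. -/
theorem totalDeriv_eq_sum {n : ℕ} {f : DiffPoly U} (hf : f ∈ degGrade U n) :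
    totalDeriv f = ∑ i, ∑ s ∈ Finset.range (n + 1), jetPartial i s f * X (i, s) := by
  have h : MvPolynomial.mkDerivation (Smooth U)
      (fun v : Fin N × ℕ => (X (v.1, v.2 + 1) : DiffPoly U)) f =
      ∑ i, ∑ s ∈ Finset.range n, jetPartial i (s + 1) f * X (i, s + 1) := by
    have hD : MvPolynomial.mkDerivation (Smooth U)
        (fun v : Fin N × ℕ => (X (v.1, v.2 + 1) : DiffPoly U)) f =
        (∑ i : Fin N, ∑ s ∈ Finset.range n,
          (X (i, s + 1) : DiffPoly U) • MvPolynomial.pderiv (R := Smooth U) (i, s)) f := by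
      -- Two derivations need only be compared on the variables that occur in `f`, and homogeneity
      -- of degree `n` bounds their order.
      refine MvPolynomial.derivation_eq_of_forall_mem_vars fun v hv => ?_
      have hvn : v.2 < n := by
        by_contra hvn
        obtain ⟨d, hd, hdv⟩ := (MvPolynomial.mem_vars_iff_mem_support v).1 hv
        have h1 := hf d (MvPolynomial.mem_support_iff.1 hd)
        have hle : v.2 + 1 ≤ Finsupp.weight (fun v : Fin N × ℕ => v.2 + 1) d :=
          Finsupp.le_weight_of_ne_zero' (fun v : Fin N × ℕ => v.2 + 1) (Finsupp.mem_support_iff.1 hdv)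
        omega
      rw [MvPolynomial.mkDerivation_X, derivation_sum_apply,
        Finset.sum_eq_single v.1, derivation_sum_apply, Finset.sum_eq_single v.2]
      · simp
      · intro s _ hs
        rw [Derivation.smul_apply, MvPolynomial.pderiv_X_of_ne (by
          intro h; exact hs (congrArg Prod.snd h).symm), smul_zero]
      · intro h; exact absurd (Finset.mem_range.2 hvn) h
      · intro i _ hi
        rw [derivation_sum_apply]
        refine Finset.sum_eq_zero fun s _ => ?_
        rw [Derivation.smul_apply, MvPolynomial.pderiv_X_of_ne (by
          intro h; exact hi (congrArg Prod.fst h).symm), smul_zero]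
      · intro h; exact absurd (Finset.mem_univ _) h
    rw [hD, derivation_sum_apply]
    refine Finset.sum_congr rfl fun i _ => ?_
    rw [derivation_sum_apply]
    refine Finset.sum_congr rfl fun s _ => ?_
    rw [Derivation.smul_apply, smul_eq_mul, mul_comm]
    rfl
  rw [totalDeriv_apply, h, ← Finset.sum_add_distrib]
  refine Finset.sum_congr rfl fun i _ => ?_
  rw [Finset.sum_range_succ', add_comm]

theorem totalDeriv_mem_degGrade {z : ℤ} {f : DiffPoly U} (hf : f ∈ degGrade U z) :
    totalDeriv f ∈ degGrade U (z + 1) := by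
  rcases lt_or_ge z 0 with hz | hz
  · rw [degGrade_eq_zero hz hf, map_zero]; exact zero_mem _
  · obtain ⟨n, rfl⟩ := Int.eq_ofNat_of_zero_le hz
    rw [totalDeriv_eq_sum hf]
    refine sum_mem fun i _ => sum_mem fun s _ => ?_
    have := mul_mem_degGrade (jetPartial_mem_degGrade hf i s) (X_mem_degGrade (U := U) (i, s))
    convert this using 1
    ring_nf

theorem isDiffGrading_degGrade (U : TopologicalSpace.Opens (Fin N → ℝ)) :
    IsDiffGrading (totalDeriv (U := U)) (degGrade U) where
  one_mem := by simpa using C_mem_degGrade (1 : Smooth U)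
  mul_mem := mul_mem_degGrade
  der_mem := totalDeriv_mem_degGrade
  eq_zero := degGrade_eq_zero

/-- On symbols `∂_x` acts as `∂_x + ξ`. The shift by `ξ` commutes with multiplication by `f`, so the
commutator comes from the Leibniz rule alone. -/
theorem dOp_mul_mulOp (f : DiffPoly U) :
    dOp U * mulOp U f = mulOp U f * dOp U + mulOp U (totalDeriv f) := by
  refine PsiDO.ext fun g => ?_
  ext1
  funext k
  change (dEnd U (f • g)).coeff k = (f • dEnd U g + totalDeriv f • g).coeff k
  rw [HahnSeries.coeff_add, HahnSeries.coeff_smul, HahnSeries.coeff_smul, dEnd_coeff, dEnd_coeff,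
    HahnSeries.coeff_smul, HahnSeries.coeff_smul]
  simp only [smul_eq_mul, totalDeriv_mul]
  ring

theorem epsTotalDeriv_mul (F G : EpsDiffPoly U) :
    epsTotalDeriv (F * G) = epsTotalDeriv F * G + F * epsTotalDeriv G := by
  ext1 n
  simp only [epsTotalDeriv, PowerSeries.coeff_mk, map_add, PowerSeries.coeff_mul, map_sum,
    totalDeriv_mul, Finset.sum_add_distrib]

theorem epsTotalDeriv_add (F G : EpsDiffPoly U) :
    epsTotalDeriv (F + G) = epsTotalDeriv F + epsTotalDeriv G := by
  ext1 n
  simp [epsTotalDeriv]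

theorem epsTotalDeriv_C (f : DiffPoly U) :
    epsTotalDeriv (PowerSeries.C f) = PowerSeries.C (totalDeriv f) := by
  ext1 n
  rw [epsTotalDeriv, PowerSeries.coeff_mk, PowerSeries.coeff_C, PowerSeries.coeff_C,
    apply_ite totalDeriv, map_zero]

end DiffPolyCalculus

/-! ### Substitution of a Miura-reciprocal transformation -/

/-- Regroups a square of indices by antidiagonals when the part on or beyond the diagonal `i + j =
n` vanishes. For Taylor terms this vanishing is divisibility by a high power of `ε`. -/
theorem sum_range_mul_sum_range_eq {M : Type*} [AddCommMonoid M] (F : ℕ → ℕ → M) (n : ℕ)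
    (hF : ∀ i j, n ≤ i + j → F i j = 0) :
    ∑ i ∈ Finset.range n, ∑ j ∈ Finset.range n, F i j =
      ∑ m ∈ Finset.range n, ∑ p ∈ Finset.HasAntidiagonal.antidiagonal m, F p.1 p.2 := by
  rw [← Finset.sum_product']
  have h1 : ∑ p ∈ Finset.range n ×ˢ Finset.range n with p.1 + p.2 < n, F p.1 p.2 =
      ∑ p ∈ Finset.range n ×ˢ Finset.range n, F p.1 p.2 := by
    refine Finset.sum_filter_of_ne fun p _ hp => ?_
    by_contra h
    exact hp (hF _ _ (not_lt.1 h))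
  rw [← h1, ← Finset.sum_fiberwise_of_maps_to (t := Finset.range n)
    (g := fun p : ℕ × ℕ => p.1 + p.2) (f := fun p : ℕ × ℕ => F p.1 p.2) fun p hp => Finset.mem_range.2 (Finset.mem_filter.1 hp).2]
  refine Finset.sum_congr rfl fun m hm => Finset.sum_congr ?_ fun _ _ => rfl
  ext p
  have := Finset.mem_range.1 hm
  simp only [Finset.mem_filter, Finset.mem_product, Finset.mem_range,
    Finset.HasAntidiagonal.mem_antidiagonal]
  omega

theorem partialDeriv_algebraMap {N : ℕ} {U : TopologicalSpace.Opens (Fin N → ℝ)} (i : Fin N)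
    (c : ℝ) : partialDeriv i (algebraMap ℝ (Smooth U) c) = 0 := by
  refine Smooth.ext fun x => ?_
  have h : extend (algebraMap ℝ (Smooth U) c).1 =ᶠ[nhds (x : Fin N → ℝ)] fun _ => c :=
    eventuallyEq_of_eqOn (extend_eqOn (algebraMap ℝ (Smooth U) c).1 _ fun _ => rfl) x
  rw [partialDeriv_apply, h.fderiv_eq, fderiv_fun_const]
  rfl

namespace Transformation

open MvPolynomial (X C coeff)

variable {N : ℕ} {U W : TopologicalSpace.Opens (Fin N → ℝ)} (T : Transformation U W)

/-- The leading part of `w^i`, as an element of `𝒜[[ε]]`. -/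
def lead (i : Fin N) : EpsDiffPoly U := PowerSeries.C (C (T.K₀ i))

/-- The part of `w^i` of positive order in `ε`. -/
def rest (i : Fin N) : EpsDiffPoly U := T.Q i - T.lead i

theorem taylorTerm_zero (f : Smooth W) :
    T.taylorTerm 0 f = PowerSeries.C (C (pullbackHom T.K₀ T.K₀_mem f)) := rfl

theorem taylorTerm_succ (n : ℕ) (f : Smooth W) :
    T.taylorTerm (n + 1) f = ∑ i, T.taylorTerm n (partialDeriv i f) * T.rest i := rfl

theorem K_zero (i : Fin N) : T.K i 0 = C (T.K₀ i) :=
  eq_C_of_mem_degGrade_zero (hasDegree_iff.1 (T.K_degree i 0))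

theorem H_zero : T.H 0 = C (MvPolynomial.constantCoeff (T.H 0)) :=
  eq_C_of_mem_degGrade_zero (hasDegree_iff.1 (T.H_degree 0))

theorem B_mem : T.B ∈ epsGrade (degGrade U) 0 := fun n => by
  rw [B, PowerSeries.coeff_mk, add_zero]
  exact hasDegree_iff.1 (T.H_degree n)

theorem Q_mem (i : Fin N) : T.Q i ∈ epsGrade (degGrade U) 0 := fun n => by
  rw [Q, PowerSeries.coeff_mk, add_zero]
  exact hasDegree_iff.1 (T.K_degree i n)

theorem lead_mem (i : Fin N) : T.lead i ∈ epsGrade (degGrade U) 0 :=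
  C_mem_epsGrade (C_mem_degGrade _)

theorem rest_mem (i : Fin N) : T.rest i ∈ epsGrade (degGrade U) 0 :=
  sub_mem (T.Q_mem i) (T.lead_mem i)

theorem X_dvd_rest (i : Fin N) : PowerSeries.X ∣ T.rest i := by
  rw [PowerSeries.X_dvd_iff, rest, map_sub, lead, PowerSeries.constantCoeff_C, ← T.K_zero, Q,
    ← PowerSeries.coeff_zero_eq_constantCoeff_apply, PowerSeries.coeff_mk, sub_self]

theorem lead_add_rest (i : Fin N) : T.lead i + T.rest i = T.Q i := add_sub_cancel _ _

theorem taylorTerm_map_add (n : ℕ) (f g : Smooth W) :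
    T.taylorTerm n (f + g) = T.taylorTerm n f + T.taylorTerm n g := by
  induction n generalizing f g with
  | zero => simp [taylorTerm_zero]
  | succ n ih => simp only [taylorTerm_succ, map_add, ih, add_mul, Finset.sum_add_distrib]

theorem taylorTerm_map_zero (n : ℕ) : T.taylorTerm n (0 : Smooth W) = 0 := by
  have := T.taylorTerm_map_add n 0 0
  simpa using this

/-- The higher Leibniz rule for repeated differentiation in the direction `h = Q - K_0`; the
induction step is Pascal's rule. -/
theorem taylorTerm_mul (n : ℕ) (f g : Smooth W) : T.taylorTerm n (f * g) =
    ∑ p ∈ Finset.HasAntidiagonal.antidiagonal n,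
      (n.choose p.1 : EpsDiffPoly U) * (T.taylorTerm p.1 f * T.taylorTerm p.2 g) := by
  induction n generalizing f g with
  | zero => simp [taylorTerm_zero]
  | succ n ih =>
    rw [Finset.sum_antidiagonal_choose_succ_mul
      (fun i j => T.taylorTerm i f * T.taylorTerm j g), taylorTerm_succ]
    simp only [partialDeriv_mul, taylorTerm_map_add, ih, add_mul, Finset.sum_add_distrib]
    rw [add_comm]
    congr 1
    · simp only [taylorTerm_succ, Finset.mul_sum, Finset.sum_mul]
      rw [Finset.sum_comm]
      refine Finset.sum_congr rfl fun p _ => Finset.sum_congr rfl fun i _ => ?_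
      ring
    · simp only [taylorTerm_succ, Finset.mul_sum, Finset.sum_mul]
      rw [Finset.sum_comm]
      refine Finset.sum_congr rfl fun p hp => Finset.sum_congr rfl fun i _ => ?_
      rw [Nat.choose_symm_of_eq_add (Finset.HasAntidiagonal.mem_antidiagonal.1 hp).symm]
      ring

theorem X_pow_dvd_taylorTerm (n : ℕ) (f : Smooth W) : PowerSeries.X ^ n ∣ T.taylorTerm n f := by
  induction n generalizing f with
  | zero => simp
  | succ n ih =>
    rw [taylorTerm_succ]
    refine Finset.dvd_sum fun i _ => ?_
    rw [pow_succ]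
    exact mul_dvd_mul (ih _) (T.X_dvd_rest i)

theorem taylorTerm_mem (n : ℕ) (f : Smooth W) :
    T.taylorTerm n f ∈ epsGrade (degGrade U) 0 := by
  induction n generalizing f with
  | zero => exact C_mem_epsGrade (C_mem_degGrade _)
  | succ n ih =>
    rw [taylorTerm_succ]
    refine sum_mem fun i _ => ?_
    simpa using mul_mem_epsGrade mul_mem_degGrade (ih (partialDeriv i f)) (T.rest_mem i)

/-- The coefficient `1/n!` of Taylor's formula. -/
def invFactorial (U : TopologicalSpace.Opens (Fin N → ℝ)) (n : ℕ) : EpsDiffPoly U :=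
  PowerSeries.C (C (algebraMap ℝ (Smooth U) ((n.factorial : ℝ)⁻¹)))

theorem invFactorial_mul (n : ℕ) : invFactorial U n * (n.factorial : EpsDiffPoly U) = 1 := by
  have h : ((n.factorial : ℝ)⁻¹) * (n.factorial : ℝ) = 1 :=
    inv_mul_cancel₀ (Nat.cast_ne_zero.2 n.factorial_ne_zero)
  have := congrArg (fun c : ℝ => (PowerSeries.C (C (algebraMap ℝ (Smooth U) c)) : EpsDiffPoly U)) h
  simpa [map_mul, invFactorial] using this

theorem epsTotalDeriv_invFactorial_mul (n : ℕ) (F : EpsDiffPoly U) :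
    epsTotalDeriv (invFactorial U n * F) = invFactorial U n * epsTotalDeriv F := by
  rw [epsTotalDeriv_mul, invFactorial, epsTotalDeriv_C, totalDeriv_C]
  simp [partialDeriv_algebraMap]

/-- The `n`-th Taylor term of `f(K_0 + h)`. -/
def taylor (n : ℕ) (f : Smooth W) : EpsDiffPoly U := invFactorial U n * T.taylorTerm n f

theorem X_pow_dvd_taylor (n : ℕ) (f : Smooth W) : PowerSeries.X ^ n ∣ T.taylor n f :=
  (T.X_pow_dvd_taylorTerm n f).mul_left _

/-- The Taylor term of order `n` is divisible by `ε^n`, so any truncation beyond order `m` computes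
the coefficient. Identities for the substitution thus reduce to identities for finite Taylor sums.
-/
theorem coeff_substSmooth {m M : ℕ} (h : m < M) (f : Smooth W) :
    PowerSeries.coeff m (T.substSmooth f) =
      PowerSeries.coeff m (∑ n ∈ Finset.range M, T.taylor n f) := by
  have h1 : PowerSeries.coeff m (T.substSmooth f) =
      ∑ n ∈ Finset.range (m + 1), PowerSeries.coeff m (T.taylor n f) := by
    rw [substSmooth, PowerSeries.coeff_mk]
    refine Finset.sum_congr rfl fun n _ => ?_
    rw [taylor, invFactorial, PowerSeries.coeff_C_mul, Algebra.smul_def]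
    rfl
  rw [h1, map_sum]
  refine Finset.sum_subset (Finset.range_subset_range.2 h) fun n _ hn => ?_
  exact PowerSeries.X_pow_dvd_iff.1 (T.X_pow_dvd_taylor n f) m
    (by simpa [Finset.mem_range] using hn)

theorem taylor_mul (n : ℕ) (f g : Smooth W) : T.taylor n (f * g) =
    ∑ p ∈ Finset.HasAntidiagonal.antidiagonal n, T.taylor p.1 f * T.taylor p.2 g := by
  rw [taylor, taylorTerm_mul, Finset.mul_sum]
  refine Finset.sum_congr rfl fun p hp => ?_
  have hn := Finset.HasAntidiagonal.mem_antidiagonal.1 hp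
  have h1 : (n.choose p.1 : EpsDiffPoly U) * (p.1.factorial * p.2.factorial) = n.factorial := by
    rw [← hn, ← mul_assoc, Nat.choose_symm_add, ← Nat.cast_mul, ← Nat.cast_mul,
      Nat.add_choose_mul_factorial_mul_factorial]
  have h2 : invFactorial U n * (n.choose p.1 : EpsDiffPoly U) =
      invFactorial U p.1 * invFactorial U p.2 := by
    calc _ = invFactorial U n * (n.choose p.1 : EpsDiffPoly U) *
          ((invFactorial U p.1 * p.1.factorial) * (invFactorial U p.2 * p.2.factorial)) := by
          rw [invFactorial_mul, invFactorial_mul, mul_one, mul_one]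
      _ = (invFactorial U n * ((n.choose p.1 : EpsDiffPoly U) *
          (p.1.factorial * p.2.factorial))) * (invFactorial U p.1 * invFactorial U p.2) := by ring
      _ = _ := by rw [h1, invFactorial_mul, one_mul]
  rw [taylor, taylor, ← mul_assoc, h2]
  ring

theorem coeff_mul_congr {R : Type*} [CommRing R] {F F' G G' : PowerSeries R} {m : ℕ}
    (hF : ∀ k ≤ m, PowerSeries.coeff k F = PowerSeries.coeff k F')
    (hG : ∀ k ≤ m, PowerSeries.coeff k G = PowerSeries.coeff k G') :
    PowerSeries.coeff m (F * G) = PowerSeries.coeff m (F' * G') := by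
  rw [PowerSeries.coeff_mul, PowerSeries.coeff_mul]
  refine Finset.sum_congr rfl fun p hp => ?_
  have hn := Finset.HasAntidiagonal.mem_antidiagonal.1 hp
  rw [hF p.1 (by omega), hG p.2 (by omega)]

theorem substSmooth_mul (f g : Smooth W) :
    T.substSmooth (f * g) = T.substSmooth f * T.substSmooth g := by
  ext1 m
  have hc : ∀ f : Smooth W, ∀ k ≤ m, PowerSeries.coeff k (T.substSmooth f) =
      PowerSeries.coeff k (∑ n ∈ Finset.range (m + 1), T.taylor n f) :=
    fun f k hk => T.coeff_substSmooth (Nat.lt_succ_of_le hk) f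
  rw [coeff_mul_congr (hc f) (hc g), hc _ m le_rfl, Finset.sum_mul_sum]
  simp only [map_sum, taylor_mul]
  refine (sum_range_mul_sum_range_eq (fun i j => PowerSeries.coeff m (T.taylor i f * T.taylor j g))
    (m + 1) fun i j hij => ?_).symm
  have hd : PowerSeries.X ^ (i + j) ∣ T.taylor i f * T.taylor j g := by
    rw [pow_add]
    exact mul_dvd_mul (T.X_pow_dvd_taylor i f) (T.X_pow_dvd_taylor j g)
  exact PowerSeries.X_pow_dvd_iff.1 hd m (by omega)

theorem substSmooth_add (f g : Smooth W) :
    T.substSmooth (f + g) = T.substSmooth f + T.substSmooth g := by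
  ext1 m
  simp only [substSmooth, PowerSeries.coeff_mk, map_add, taylorTerm_map_add, smul_add,
    Finset.sum_add_distrib]

theorem substSmooth_one : T.substSmooth 1 = 1 := by
  ext1 m
  rw [T.coeff_substSmooth (Nat.lt_succ_self m), Finset.sum_range_succ']
  have h : ∀ n, T.taylor (n + 1) 1 = 0 := fun n => by
    simp [taylor, taylorTerm_succ, partialDeriv_one, taylorTerm_map_zero]
  have h0 : T.taylor 0 1 = 1 := by
    have := invFactorial_mul (U := U) 0
    simp only [Nat.factorial_zero, Nat.cast_one, mul_one] at this
    rw [taylor, this, taylorTerm_zero, map_one, map_one, map_one, one_mul]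
  simp only [h, h0, Finset.sum_const_zero, zero_add]

/-- The substitution of `w = Q` in functions, as a ring homomorphism. -/
def substSmoothHom : Smooth W →+* EpsDiffPoly U where
  toFun := T.substSmooth
  map_one' := T.substSmooth_one
  map_mul' := T.substSmooth_mul
  map_zero' := by
    have := T.substSmooth_add 0 0
    simpa using this
  map_add' := T.substSmooth_add

theorem substSmooth_mem (f : Smooth W) : T.substSmooth f ∈ epsGrade (degGrade U) 0 := by
  intro m
  rw [T.coeff_substSmooth (Nat.lt_succ_self m)]
  suffices h : ∑ n ∈ Finset.range (m + 1), T.taylor n f ∈ epsGrade (degGrade U) 0 from h m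
  refine sum_mem fun n _ => ?_
  have h : invFactorial U n ∈ epsGrade (degGrade U) 0 := C_mem_epsGrade (C_mem_degGrade _)
  simpa [taylor] using mul_mem_epsGrade mul_mem_degGrade h (T.taylorTerm_mem n f)

theorem constantCoeff_substSmooth (f : Smooth W) :
    PowerSeries.constantCoeff (T.substSmooth f) = C (pullbackHom T.K₀ T.K₀_mem f) := by
  rw [← PowerSeries.coeff_zero_eq_constantCoeff_apply, substSmooth, PowerSeries.coeff_mk]
  simp [taylorTerm_zero]

/-! ### The chain rule for the substitution -/

theorem epsTotalDeriv_taylorTerm_zero (f : Smooth W) : epsTotalDeriv (T.taylorTerm 0 f) =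
    ∑ j, T.taylorTerm 0 (partialDeriv j f) * epsTotalDeriv (T.lead j) := by
  simp only [taylorTerm_zero, lead, epsTotalDeriv_C, totalDeriv_C]
  change PowerSeries.C (∑ i, C (partialDeriv i (pullback T.K₀ T.K₀_mem f)) * X (i, 0)) = _
  simp only [partialDeriv_pullback, map_sum, map_mul, Finset.sum_mul, Finset.mul_sum]
  rw [Finset.sum_comm]
  refine Finset.sum_congr rfl fun i _ => Finset.sum_congr rfl fun j _ => ?_
  rw [mul_assoc]
  rfl

theorem epsTotalDeriv_sum {α : Type*} (s : Finset α) (F : α → EpsDiffPoly U) :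
    epsTotalDeriv (∑ i ∈ s, F i) = ∑ i ∈ s, epsTotalDeriv (F i) := by
  ext1 n
  simp [epsTotalDeriv]

/-- Either the derivatives of `f` at `K_0` are differentiated, which produces `∂_x K_0`, or one of
the `n + 1` equivalent factors `h` is. The symmetry of the higher partial derivatives makes these
factors equivalent; after division by the factorial the count `n + 1` disappears. -/
theorem epsTotalDeriv_taylorTerm_succ (n : ℕ) (f : Smooth W) :
    epsTotalDeriv (T.taylorTerm (n + 1) f) =
      ∑ j, T.taylorTerm (n + 1) (partialDeriv j f) * epsTotalDeriv (T.lead j) +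
      (n + 1 : EpsDiffPoly U) * ∑ j, T.taylorTerm n (partialDeriv j f) *
        epsTotalDeriv (T.rest j) := by
  induction n generalizing f with
  | zero =>
    rw [taylorTerm_succ, epsTotalDeriv_sum]
    simp only [epsTotalDeriv_mul, epsTotalDeriv_taylorTerm_zero, Finset.sum_add_distrib]
    rw [Nat.cast_zero, zero_add (1 : EpsDiffPoly U), one_mul]
    refine congrArg (· + _) ?_
    simp only [taylorTerm_succ, Finset.sum_mul]
    rw [Finset.sum_comm]
    refine Finset.sum_congr rfl fun i _ => Finset.sum_congr rfl fun j _ => ?_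
    rw [partialDeriv_comm]
    ring
  | succ n ih =>
    rw [taylorTerm_succ, epsTotalDeriv_sum]
    simp only [epsTotalDeriv_mul, ih, Finset.sum_add_distrib, add_mul]
    have h1 : ∑ i, (∑ j, T.taylorTerm (n + 1) (partialDeriv j (partialDeriv i f)) *
        epsTotalDeriv (T.lead j)) * T.rest i =
        ∑ j, T.taylorTerm (n + 1 + 1) (partialDeriv j f) * epsTotalDeriv (T.lead j) := by
      simp only [taylorTerm_succ _ (n + 1), Finset.sum_mul]
      rw [Finset.sum_comm]
      refine Finset.sum_congr rfl fun i _ => Finset.sum_congr rfl fun j _ => ?_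
      rw [partialDeriv_comm]
      ring
    have h2 : ∑ i, (∑ j, T.taylorTerm n (partialDeriv j (partialDeriv i f)) *
        epsTotalDeriv (T.rest j)) * T.rest i =
        ∑ j, T.taylorTerm (n + 1) (partialDeriv j f) * epsTotalDeriv (T.rest j) := by
      simp only [taylorTerm_succ _ n, Finset.sum_mul]
      rw [Finset.sum_comm]
      refine Finset.sum_congr rfl fun i _ => Finset.sum_congr rfl fun j _ => ?_
      rw [partialDeriv_comm]
      ring
    have h3 : ∑ i, (n : EpsDiffPoly U) * (∑ j, T.taylorTerm n (partialDeriv j (partialDeriv i f)) *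
        epsTotalDeriv (T.rest j)) * T.rest i = (n : EpsDiffPoly U) *
        ∑ j, T.taylorTerm (n + 1) (partialDeriv j f) * epsTotalDeriv (T.rest j) := by
      rw [← h2, Finset.mul_sum]
      exact Finset.sum_congr rfl fun i _ => mul_assoc _ _ _
    simp only [one_mul]
    rw [h1, h2, h3]
    push_cast
    ring

theorem epsTotalDeriv_taylor_zero (f : Smooth W) : epsTotalDeriv (T.taylor 0 f) =
    ∑ j, T.taylor 0 (partialDeriv j f) * epsTotalDeriv (T.lead j) := by
  rw [taylor, epsTotalDeriv_invFactorial_mul, epsTotalDeriv_taylorTerm_zero, Finset.mul_sum]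
  exact Finset.sum_congr rfl fun j _ => (mul_assoc _ _ _).symm

theorem epsTotalDeriv_taylor_succ (n : ℕ) (f : Smooth W) : epsTotalDeriv (T.taylor (n + 1) f) =
    ∑ j, T.taylor (n + 1) (partialDeriv j f) * epsTotalDeriv (T.lead j) +
      ∑ j, T.taylor n (partialDeriv j f) * epsTotalDeriv (T.rest j) := by
  have h : invFactorial U (n + 1) * (n + 1 : EpsDiffPoly U) = invFactorial U n := by
    have h1 := invFactorial_mul (U := U) (n + 1)
    rw [Nat.factorial_succ] at h1
    push_cast at h1
    calc _ = invFactorial U (n + 1) * (n + 1 : EpsDiffPoly U) *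
          (invFactorial U n * n.factorial) := by rw [invFactorial_mul, mul_one]
      _ = invFactorial U n * (invFactorial U (n + 1) *
          ((n + 1 : EpsDiffPoly U) * n.factorial)) := by ring
      _ = _ := by rw [h1, mul_one]
  rw [taylor, epsTotalDeriv_invFactorial_mul, epsTotalDeriv_taylorTerm_succ, mul_add, ← mul_assoc,
    h, Finset.mul_sum, Finset.mul_sum]
  exact congrArg₂ (· + ·) (Finset.sum_congr rfl fun j _ => (mul_assoc _ _ _).symm)
    (Finset.sum_congr rfl fun j _ => (mul_assoc _ _ _).symm)

/-- The chain rule `∂_x (f(Q)) = ∑ (∂f/∂w^j)(Q) ∂_x Q^j`. -/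
theorem epsTotalDeriv_substSmooth (f : Smooth W) : epsTotalDeriv (T.substSmooth f) =
    ∑ j, T.substSmooth (partialDeriv j f) * epsTotalDeriv (T.Q j) := by
  ext1 m
  have hc : ∀ f : Smooth W, ∀ k ≤ m, PowerSeries.coeff k (T.substSmooth f) =
      PowerSeries.coeff k (∑ n ∈ Finset.range (m + 1), T.taylor n f) :=
    fun f k hk => T.coeff_substSmooth (Nat.lt_succ_of_le hk) f
  have hl : PowerSeries.coeff m (epsTotalDeriv (T.substSmooth f)) =
      PowerSeries.coeff m (∑ n ∈ Finset.range (m + 1), epsTotalDeriv (T.taylor n f)) := by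
    rw [← epsTotalDeriv_sum, epsTotalDeriv, epsTotalDeriv, PowerSeries.coeff_mk,
      PowerSeries.coeff_mk, hc f m le_rfl]
  have hr : PowerSeries.coeff m (∑ j, T.substSmooth (partialDeriv j f) * epsTotalDeriv (T.Q j)) =
      PowerSeries.coeff m (∑ j, (∑ n ∈ Finset.range (m + 1), T.taylor n (partialDeriv j f)) *
        epsTotalDeriv (T.Q j)) := by
    rw [map_sum, map_sum]
    exact Finset.sum_congr rfl fun j _ => coeff_mul_congr (hc _) fun _ _ => rfl
  -- The top term left over by the index shift has order at least `m + 1` in `ε`: `m` from the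
  -- Taylor term and one more from `∂_x h`.
  have hz : ∀ j, PowerSeries.coeff m (T.taylor m (partialDeriv j f) *
      epsTotalDeriv (T.rest j)) = 0 := by
    intro j
    have hX : PowerSeries.X ∣ epsTotalDeriv (T.rest j) := by
      have := PowerSeries.X_dvd_iff.1 (T.X_dvd_rest j)
      rw [PowerSeries.X_dvd_iff, ← PowerSeries.coeff_zero_eq_constantCoeff_apply, epsTotalDeriv,
        PowerSeries.coeff_mk, PowerSeries.coeff_zero_eq_constantCoeff_apply, this, map_zero]
    have hd := mul_dvd_mul (T.X_pow_dvd_taylor m (partialDeriv j f)) hX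
    rw [← pow_succ] at hd
    exact PowerSeries.X_pow_dvd_iff.1 hd m (Nat.lt_succ_self m)
  rw [hl, hr]
  have e1 : ∑ j, (∑ n ∈ Finset.range (m + 1), T.taylor n (partialDeriv j f)) *
        epsTotalDeriv (T.Q j) =
      ∑ n ∈ Finset.range (m + 1), ∑ j, T.taylor n (partialDeriv j f) * epsTotalDeriv (T.lead j) +
      ∑ n ∈ Finset.range (m + 1), ∑ j, T.taylor n (partialDeriv j f) * epsTotalDeriv (T.rest j) := by
    simp only [← lead_add_rest, epsTotalDeriv_add, mul_add, Finset.sum_add_distrib, Finset.sum_mul]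
    exact congrArg₂ (· + ·) Finset.sum_comm Finset.sum_comm
  -- Differentiation links the term `n + 1` with the `∂_x h`-part of the term `n`. Hence the bottom
  -- term is split off from the sums of derivatives and of `∂_x K_0`-parts, but the top term from
  -- that of `∂_x h`-parts.
  rw [e1, Finset.sum_range_succ', Finset.sum_range_succ' (fun n => ∑ j, T.taylor n
    (partialDeriv j f) * epsTotalDeriv (T.lead j)), Finset.sum_range_succ (fun n => ∑ j, T.taylor n
    (partialDeriv j f) * epsTotalDeriv (T.rest j))]
  simp only [epsTotalDeriv_taylor_succ, epsTotalDeriv_taylor_zero, Finset.sum_add_distrib]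
  have hz' : PowerSeries.coeff m (∑ j, T.taylor m (partialDeriv j f) *
      epsTotalDeriv (T.rest j)) = 0 := by
    rw [map_sum]
    exact Finset.sum_eq_zero fun j _ => hz j
  simp only [map_add, hz', add_zero]
  exact add_right_comm _ _ _

/-- The substitution in differential polynomials, as a ring homomorphism. -/
def substHom : DiffPoly W →+* EpsDiffPoly U :=
  MvPolynomial.eval₂Hom T.substSmoothHom fun v => T.jet v.1 (v.2 + 1)

theorem subst_eq (f : DiffPoly W) : T.subst f = T.substHom f := by
  rw [substHom, MvPolynomial.coe_eval₂Hom, MvPolynomial.eval₂_eq]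
  rfl

theorem substHom_C (f : Smooth W) : T.substHom (C f) = T.substSmooth f :=
  MvPolynomial.eval₂Hom_C _ _ _

theorem substHom_X (v : Fin N × ℕ) : T.substHom (X v) = T.jet v.1 (v.2 + 1) :=
  MvPolynomial.eval₂Hom_X' _ _ _

theorem B_mul_Binv : T.B * T.Binv = 1 := Ring.mul_inverse_cancel _ T.isUnit_B

theorem Binv_mul_B : T.Binv * T.B = 1 := Ring.inverse_mul_cancel _ T.isUnit_B

/-- The substitution intertwines `∂_y` with `B⁻¹ ∂_x`. -/
theorem substHom_totalDeriv (f : DiffPoly W) :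
    T.substHom (totalDeriv f) = T.Binv * epsTotalDeriv (T.substHom f) := by
  induction f using MvPolynomial.induction_on with
  | C a =>
    rw [totalDeriv_C, substHom_C, epsTotalDeriv_substSmooth, map_sum, Finset.mul_sum]
    refine Finset.sum_congr rfl fun i _ => ?_
    rw [map_mul, substHom_C, substHom_X]
    change _ * (T.Binv * epsTotalDeriv (T.Q i)) = _
    ring
  | add f g hf hg => rw [map_add, map_add, hf, hg, map_add, epsTotalDeriv_add, mul_add]
  | mul_X f v hf =>
    rw [totalDeriv_mul, map_add, map_mul, map_mul, map_mul, hf, totalDeriv_X, substHom_X,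
      substHom_X, epsTotalDeriv_mul]
    change _ + _ * (T.Binv * epsTotalDeriv (T.jet v.1 (v.2 + 1))) = _
    ring

/-! ### Homogeneity and surjectivity of the substitution -/

theorem constantCoeff_B : PowerSeries.constantCoeff T.B = T.H 0 := by
  rw [← PowerSeries.coeff_zero_eq_constantCoeff_apply, B, PowerSeries.coeff_mk]

/-- The equation `B B⁻¹ = 1` determines the coefficients of `B⁻¹` recursively after division by
`H_0`, and the recursion respects the degree. -/
theorem Binv_mem : T.Binv ∈ epsGrade (degGrade U) 0 := by
  have hu : IsUnit (T.H 0) := T.constantCoeff_B ▸ T.isUnit_B.map PowerSeries.constantCoeff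
  obtain ⟨b, hb⟩ := hu.exists_right_inv
  -- The inverse of `H_0` is replaced by its constant coefficient, which is visibly of degree zero
  -- and is still an inverse because `H_0` is a function.
  have hb0 : C (MvPolynomial.constantCoeff b) * T.H 0 = 1 := by
    have h := congrArg (fun f => (C (MvPolynomial.constantCoeff f) : DiffPoly U)) hb
    simp only [map_mul, map_one] at h
    rw [← T.H_zero] at h
    rw [mul_comm, h]
  intro n
  induction n using Nat.strong_induction_on with
  | _ n ih =>
    have h := congrArg (PowerSeries.coeff n) T.B_mul_Binv
    rw [PowerSeries.coeff_mul] at h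
    have h1 : ∑ p ∈ Finset.HasAntidiagonal.antidiagonal n,
        PowerSeries.coeff p.1 T.B * PowerSeries.coeff p.2 T.Binv =
        T.H 0 * PowerSeries.coeff n T.Binv + ∑ p ∈ (Finset.HasAntidiagonal.antidiagonal n).erase (0, n),
        PowerSeries.coeff p.1 T.B * PowerSeries.coeff p.2 T.Binv := by
      rw [← Finset.add_sum_erase _ _ (show (0, n) ∈ Finset.HasAntidiagonal.antidiagonal n by simp)]
      simp [constantCoeff_B]
    have h2 : PowerSeries.coeff n T.Binv = C (MvPolynomial.constantCoeff b) *
        (PowerSeries.coeff n 1 - ∑ p ∈ (Finset.HasAntidiagonal.antidiagonal n).erase (0, n),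
          PowerSeries.coeff p.1 T.B * PowerSeries.coeff p.2 T.Binv) := by
      rw [← h, h1, add_sub_cancel_right, ← mul_assoc, hb0, one_mul]
    rw [h2, ← zero_add ((n : ℤ) + 0)]
    refine mul_mem_degGrade (C_mem_degGrade _) (sub_mem ?_ (sum_mem fun p hp => ?_))
    · exact (C_mem_epsGrade (isDiffGrading_degGrade U).one_mem :
        (PowerSeries.C 1 : EpsDiffPoly U) ∈ epsGrade (degGrade U) 0) n
    · obtain ⟨hne, hp⟩ := Finset.mem_erase.1 hp
      have hn := Finset.HasAntidiagonal.mem_antidiagonal.1 hp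
      have hlt : p.2 < n := by
        by_contra hlt
        exact hne (Prod.ext (by simp; omega) (by simp; omega))
      have := mul_mem_degGrade (T.B_mem p.1) (ih p.2 hlt)
      convert this using 1
      rw [← hn]
      push_cast
      ring_nf

theorem epsTotalDeriv_mem {k : ℤ} {F : EpsDiffPoly U} (hF : F ∈ epsGrade (degGrade U) k) :
    epsTotalDeriv F ∈ epsGrade (degGrade U) (k + 1) := fun n => by
  rw [epsTotalDeriv, PowerSeries.coeff_mk, ← add_assoc]
  exact totalDeriv_mem_degGrade (hF n)

theorem jet_mem (i : Fin N) (s : ℕ) : T.jet i s ∈ epsGrade (degGrade U) s := by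
  induction s with
  | zero => exact T.Q_mem i
  | succ s ih =>
    have := mul_mem_epsGrade mul_mem_degGrade T.Binv_mem (epsTotalDeriv_mem ih)
    rw [zero_add] at this
    exact_mod_cast this

theorem prod_mem_of_graded {R : Type*} [CommRing R] {𝒢 : ℤ → AddSubgroup R} (h1 : 1 ∈ 𝒢 0)
    (hm : ∀ {i j x y}, x ∈ 𝒢 i → y ∈ 𝒢 j → x * y ∈ 𝒢 (i + j)) {α : Type*} {w : α → ℕ} {x : α → R}
    (hx : ∀ v, x v ∈ 𝒢 (w v)) (d : α →₀ ℕ) :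
    (d.prod fun v k => x v ^ k) ∈ 𝒢 ((Finsupp.weight w d : ℕ) : ℤ) := by
  classical
  have hp : ∀ v (k : ℕ), x v ^ k ∈ 𝒢 ((k * w v : ℕ) : ℤ) := by
    intro v k
    induction k with
    | zero => simpa using h1
    | succ k ih =>
      have := hm ih (hx v)
      rw [pow_succ]
      convert this using 1
      push_cast
      ring_nf
  induction d using Finsupp.induction with
  | zero => simpa using h1
  | single_add v k d hv hk ih =>
    have hd : Disjoint (Finsupp.single v k).support d.support := by
      rw [Finsupp.support_single _ hk]
      simpa using hv
    have e : (Finsupp.single v k).prod (fun v k => x v ^ k) = x v ^ k :=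
      Finsupp.prod_single_index (pow_zero _)
    rw [Finsupp.prod_add_index_of_disjoint hd, e, map_add, Finsupp.weight_single, smul_eq_mul,
      Nat.cast_add]
    exact hm (hp v k) ih

theorem substHom_mem {z : ℤ} {f : DiffPoly W} (hf : f ∈ degGrade W z) :
    T.substHom f ∈ epsGrade (degGrade U) z := by
  rw [← subst_eq, subst]
  refine sum_mem fun d hd => ?_
  rw [← hf d (MvPolynomial.mem_support_iff.1 hd), ← zero_add (Nat.cast _)]
  refine mul_mem_epsGrade mul_mem_degGrade (T.substSmooth_mem _) ?_
  exact prod_mem_of_graded (𝒢 := epsGrade (degGrade U))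
    (C_mem_epsGrade (isDiffGrading_degGrade U).one_mem) (mul_mem_epsGrade mul_mem_degGrade)
    (fun v => by exact_mod_cast T.jet_mem v.1 (v.2 + 1)) d

/-- The leading term of the substitution. -/
def substLead : DiffPoly W →+* DiffPoly U := PowerSeries.constantCoeff.comp T.substHom

theorem substLead_apply (f : DiffPoly W) :
    T.substLead f = PowerSeries.constantCoeff (T.substHom f) := rfl

/-- The leading order in `ε` of `B ∂_y = ∂_x`. -/
theorem H_zero_mul_substLead (f : DiffPoly W) :
    T.H 0 * T.substLead (totalDeriv f) = totalDeriv (T.substLead f) := by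
  have h : T.B * T.substHom (totalDeriv f) = epsTotalDeriv (T.substHom f) := by
    rw [substHom_totalDeriv, ← mul_assoc, B_mul_Binv, one_mul]
  have := congrArg PowerSeries.constantCoeff h
  rw [map_mul, constantCoeff_B] at this
  rw [substLead_apply, this, ← PowerSeries.coeff_zero_eq_constantCoeff_apply, epsTotalDeriv,
    PowerSeries.coeff_mk, PowerSeries.coeff_zero_eq_constantCoeff_apply, substLead_apply]

/-- The image of the homogeneous differential polynomials under the leading substitution. -/
def leadImage (z : ℤ) : AddSubgroup (DiffPoly U) := (degGrade W z).map T.substLead.toAddMonoidHom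

theorem mem_leadImage {z : ℤ} {f : DiffPoly U} :
    f ∈ T.leadImage z ↔ ∃ g ∈ degGrade W z, T.substLead g = f := Iff.rfl

theorem mul_mem_leadImage {i j : ℤ} {f g : DiffPoly U} (hf : f ∈ T.leadImage i)
    (hg : g ∈ T.leadImage j) : f * g ∈ T.leadImage (i + j) := by
  obtain ⟨f', hf', rfl⟩ := hf
  obtain ⟨g', hg', rfl⟩ := hg
  exact ⟨f' * g', mul_mem_degGrade hf' hg', map_mul T.substLead _ _⟩

theorem C_mem_leadImage (f : Smooth U) : C f ∈ T.leadImage 0 := by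
  obtain ⟨g, rfl⟩ := T.pullback_surjective f
  refine T.mem_leadImage.2 ⟨C g, C_mem_degGrade g, ?_⟩
  rw [substLead_apply, substHom_C, constantCoeff_substSmooth]

/-- To leading order `∂_x` is `H_0 ∂_y`, and `H_0`, being a function on `U`, lies in the image
itself. -/
theorem totalDeriv_mem_leadImage {z : ℤ} {f : DiffPoly U} (hf : f ∈ T.leadImage z) :
    totalDeriv f ∈ T.leadImage (z + 1) := by
  obtain ⟨g, hg, rfl⟩ := T.mem_leadImage.1 hf
  rw [← H_zero_mul_substLead, T.H_zero, ← zero_add (z + 1)]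
  exact T.mul_mem_leadImage (T.C_mem_leadImage _)
    (T.mem_leadImage.2 ⟨_, totalDeriv_mem_degGrade hg, rfl⟩)

/-- The jet variables are the iterated `∂_x`-derivatives of the coordinate functions, so functions
and stability under `∂_x` suffice. -/
theorem X_mem_leadImage (i : Fin N) (s : ℕ) :
    (X (i, s) : DiffPoly U) ∈ T.leadImage ((s + 1 : ℕ) : ℤ) := by
  induction s with
  | zero =>
    have h : (X (i, 0) : DiffPoly U) = totalDeriv (C (coord U i)) := by
      rw [totalDeriv_C]
      simp [partialDeriv_coord]
    rw [h]
    exact T.totalDeriv_mem_leadImage (T.C_mem_leadImage _)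
  | succ s ih =>
    have h : (X (i, s + 1) : DiffPoly U) = totalDeriv (X (i, s)) := (totalDeriv_X (i, s)).symm
    rw [h]
    exact_mod_cast T.totalDeriv_mem_leadImage ih

/-- The leading substitution is surjective in every degree. -/
theorem exists_substLead_eq {z : ℤ} {f : DiffPoly U} (hf : f ∈ degGrade U z) :
    ∃ g ∈ degGrade W z, T.substLead g = f := by
  have h1 : (1 : DiffPoly U) ∈ T.leadImage 0 := by
    have := T.C_mem_leadImage 1
    rwa [map_one] at this
  have hmon : ∀ d ∈ f.support, MvPolynomial.monomial d (coeff d f) ∈ T.leadImage z := by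
    intro d hd
    have hp := prod_mem_of_graded (𝒢 := T.leadImage) h1 T.mul_mem_leadImage
      (fun v : Fin N × ℕ => T.X_mem_leadImage v.1 v.2) d
    have := T.mul_mem_leadImage (T.C_mem_leadImage (coeff d f)) hp
    rwa [hf d (MvPolynomial.mem_support_iff.1 hd), zero_add, ← MvPolynomial.monomial_eq] at this
  have := sum_mem hmon
  rwa [← f.as_sum, mem_leadImage] at this

/-- Every graded series is an `ε`-series of substituted differential polynomials. -/
theorem exists_eq_epsSeries_substHom {k : ℕ} {F : EpsDiffPoly U}
    (hF : F ∈ epsGrade (degGrade U) k) :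
    ∃ g : ℕ → DiffPoly W, (∀ n, g n ∈ degGrade W ((k + n : ℕ) : ℤ)) ∧
      F = epsSeries fun n => T.substHom (g n) := by
  obtain ⟨y, hy, hF⟩ := exists_eq_epsSeries (𝒢 := degGrade U)
    (fun k y => ∃ g ∈ degGrade W k, y = T.substHom g)
    (fun k y ⟨g, hg, h⟩ => h ▸ T.substHom_mem hg)
    (fun k x hx => by
      obtain ⟨g, hg, h⟩ := T.exists_substLead_eq hx
      exact ⟨_, ⟨g, hg, rfl⟩, h⟩) hF
  choose g hg hgy using hy
  exact ⟨g, hg, by rw [hF]; congr 1; exact funext hgy⟩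

end Transformation

/-! ### Explicit adjoints of differential operators -/

section AdjCoeff

variable {A E : Type*} [CommRing A] [Ring E]

/-- The coefficients of the operator `D^s ∘ a`. -/
def conjCoeff (der : A →+ A) : ℕ → A → ℕ → A
  | 0, a, t => if t = 0 then a else 0
  | s + 1, a, 0 => der (conjCoeff der s a 0)
  | s + 1, a, t + 1 => der (conjCoeff der s a (t + 1)) + conjCoeff der s a t

theorem conjCoeff_eq_zero (der : A →+ A) {s t : ℕ} (h : s < t) (a : A) :
    conjCoeff der s a t = 0 := by
  induction s generalizing t with
  | zero => simp [conjCoeff]; omega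
  | succ s ih =>
    obtain ⟨t, rfl⟩ : ∃ r, t = r + 1 := ⟨t - 1, by omega⟩
    rw [conjCoeff, ih (by omega), ih (by omega), map_zero, add_zero]

/-- The coefficients depend only on the derivation, not on `m` and `D`. The same formula therefore
serves for operators over `W` and for their realization over `U`. -/
theorem pow_mul_map_eq_sum {der : A →+ A} {m : A →+* E} {D : E}
    (hc : ∀ a, D * m a = m a * D + m (der a)) {s n : ℕ} (h : s < n) (a : A) :
    D ^ s * m a = ∑ t ∈ Finset.range n, m (conjCoeff der s a t) * D ^ t := by
  induction s generalizing n with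
  | zero =>
    rw [Finset.sum_eq_single_of_mem 0 (Finset.mem_range.2 h) (fun t _ ht => by
      simp [conjCoeff, ht])]
    simp [conjCoeff]
  | succ s ih =>
    obtain ⟨n, rfl⟩ : ∃ r, n = r + 1 := ⟨n - 1, by omega⟩
    -- Index shift: the term added at the top vanishes because `D^s ∘ a` has order at most `s`.
    have h1 : ∑ t ∈ Finset.range n, m (der (conjCoeff der s a t)) * D ^ t =
        ∑ t ∈ Finset.range n, m (der (conjCoeff der s a (t + 1))) * D ^ (t + 1) +
          m (der (conjCoeff der s a 0)) := by
      have e := Finset.sum_range_succ' (fun t => m (der (conjCoeff der s a t)) * D ^ t) n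
      rw [Finset.sum_range_succ, conjCoeff_eq_zero der (by omega : s < n)] at e
      simpa using e
    have h2 : D * ∑ t ∈ Finset.range n, m (conjCoeff der s a t) * D ^ t =
        ∑ t ∈ Finset.range n, m (conjCoeff der s a t) * D ^ (t + 1) +
          ∑ t ∈ Finset.range n, m (der (conjCoeff der s a t)) * D ^ t := by
      rw [Finset.mul_sum, ← Finset.sum_add_distrib]
      refine Finset.sum_congr rfl fun t _ => ?_
      rw [← mul_assoc, hc, add_mul, mul_assoc, ← pow_succ']
    rw [pow_succ', mul_assoc, ih (by omega : s < n), h2, h1, Finset.sum_range_succ', ← add_assoc,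
      ← Finset.sum_add_distrib]
    simp only [conjCoeff, map_add, add_mul, pow_zero, mul_one]
    congr 1
    exact Finset.sum_congr rfl fun t _ => add_comm _ _

/-- The coefficients of the formal adjoint `∑_{s < n} (-D)^s ∘ b_s` of `∑_{s < n} b_s D^s`. -/
def adjCoeff (der : A →+ A) (n : ℕ) (b : ℕ → A) (t : ℕ) : A :=
  ∑ s ∈ Finset.range n, (-1) ^ s * conjCoeff der s (b s) t

theorem sum_neg_pow_mul_map {der : A →+ A} {m : A →+* E} {D : E}
    (hc : ∀ a, D * m a = m a * D + m (der a)) (n : ℕ) (b : ℕ → A) :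
    ∑ s ∈ Finset.range n, (-D) ^ s * m (b s) =
      ∑ t ∈ Finset.range n, m (adjCoeff der n b t) * D ^ t := by
  simp only [adjCoeff, map_sum, Finset.sum_mul]
  rw [Finset.sum_comm]
  refine Finset.sum_congr rfl fun s hs => ?_
  rw [neg_pow, mul_assoc, pow_mul_map_eq_sum hc (Finset.mem_range.1 hs), Finset.mul_sum]
  refine Finset.sum_congr rfl fun t _ => ?_
  rw [map_mul, map_pow, map_neg, map_one, mul_assoc]

theorem conjCoeff_mem {der : A →+ A} {𝒜 : ℤ → AddSubgroup A} (h𝒜 : IsDiffGrading der 𝒜)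
    {z : ℤ} {a : A} (ha : a ∈ 𝒜 z) (s t : ℕ) : conjCoeff der s a t ∈ 𝒜 (z + s - t) := by
  induction s generalizing t with
  | zero =>
    rw [conjCoeff]
    split_ifs with h
    · simpa [h] using ha
    · exact zero_mem _
  | succ s ih =>
    cases t with
    | zero =>
      have := h𝒜.der_mem (ih 0)
      rw [conjCoeff]
      convert this using 1
      push_cast
      ring_nf
    | succ t =>
      rw [conjCoeff]
      refine add_mem ?_ ?_
      · have := h𝒜.der_mem (ih (t + 1))
        convert this using 1
        push_cast
        ring_nf
      · convert ih t using 1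
        push_cast
        ring_nf

theorem adjCoeff_mem {der : A →+ A} {𝒜 : ℤ → AddSubgroup A} (h𝒜 : IsDiffGrading der 𝒜)
    {z : ℤ} {b : ℕ → A} (hb : ∀ s : ℕ, b s ∈ 𝒜 (z - s)) (n t : ℕ) :
    adjCoeff der n b t ∈ 𝒜 (z - t) := by
  refine sum_mem fun s _ => ?_
  have h := conjCoeff_mem h𝒜 (hb s) s t
  rw [sub_add_cancel] at h
  rcases neg_one_pow_eq_or A s with h' | h' <;> rw [h']
  · rwa [one_mul]
  · rw [neg_one_mul]; exact neg_mem h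

end AdjCoeff

theorem AdjointCalculus.σ_pow {R Ω : Type*} [CommRing R] [Ring Ω] (C : AdjointCalculus R Ω)
    (x : Ω) (s : ℕ) : C.σ (x ^ s) = C.σ x ^ s := by
  induction s with
  | zero => rw [pow_zero, pow_zero, C.σ_one]
  | succ s ih => rw [pow_succ, C.σ_mul, ih, ← pow_succ']

theorem AdjointCalculus.σ_sum_mul_pow {R Ω : Type*} [CommRing R] [Ring Ω]
    (C : AdjointCalculus R Ω) (n : ℕ) (a : ℕ → R) :
    C.σ (∑ s ∈ Finset.range n, C.m (a s) * C.D ^ s) =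
      ∑ s ∈ Finset.range n, (-C.D) ^ s * C.m (a s) := by
  simp only [map_sum, C.σ_mul, C.σ_m, C.σ_pow, C.σ_D]

/-! ### Pseudo-differential operators paired with their adjoints -/

section Hat

open MvPolynomial (X)

variable {N : ℕ} {U W : TopologicalSpace.Opens (Fin N → ℝ)}

/-- Pairs of a pseudo-differential operator and its formal adjoint. -/
abbrev AdjPair (U : TopologicalSpace.Opens (Fin N → ℝ)) : Type := PsiDO U × (PsiDO U)ᵐᵒᵖ

/-- The adjoint calculus of pseudo-differential operators. -/
def psiCalculus (U : TopologicalSpace.Opens (Fin N → ℝ)) :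
    AdjointCalculus (DiffPoly U) (AdjPair U) :=
  pairCalculus (mulOp U) (dOp U) (dInvOp U) totalDeriv (degGrade U) (isDiffGrading_degGrade U)
    dOp_mul_mulOp (dOp_mul_dInvOp U) (dInvOp_mul_dOp U)

/-- The adjoint calculus of `ε`-dependent pseudo-differential operators. -/
def epsCalculus (U : TopologicalSpace.Opens (Fin N → ℝ)) :
    AdjointCalculus (EpsDiffPoly U) (PowerSeries (AdjPair U)) := (psiCalculus U).eps

theorem epsCalculus_m (F : EpsDiffPoly U) :
    (epsCalculus U).m F = PowerSeries.map (psiCalculus U).m F := rfl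

theorem epsCalculus_D : (epsCalculus U).D = PowerSeries.C (psiCalculus U).D := rfl

theorem epsCalculus_der (F : EpsDiffPoly U) : (epsCalculus U).der F = epsTotalDeriv F := rfl

theorem epsCalculus_σ : (epsCalculus U).σ = epsMap (psiCalculus U).σ := rfl

/-- The operator underlying a pair. -/
def epsFst (U : TopologicalSpace.Opens (Fin N → ℝ)) :
    PowerSeries (AdjPair U) →+* EpsPsiDO U := PowerSeries.map (RingHom.fst _ _)

theorem coeff_epsFst (n : ℕ) (L : PowerSeries (AdjPair U)) :
    PowerSeries.coeff n (epsFst U L) = (PowerSeries.coeff n L).1 := PowerSeries.coeff_map _ _ _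

theorem epsFst_m (F : EpsDiffPoly U) : epsFst U ((epsCalculus U).m F) = epsMulOp U F := by
  ext1 n
  rw [coeff_epsFst, epsCalculus_m, PowerSeries.coeff_map, epsMulOp, PowerSeries.coeff_map]
  rfl

theorem epsFst_C (x : AdjPair U) : epsFst U (PowerSeries.C x) = PowerSeries.C x.1 :=
  PowerSeries.map_C _ _

theorem epsFst_D : epsFst U (epsCalculus U).D = epsD U := epsFst_C _

theorem epsFst_Di : epsFst U (epsCalculus U).Di = epsDInv U := epsFst_C _

theorem epsFst_epsSeries (L : ℕ → PowerSeries (AdjPair U)) :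
    epsFst U (epsSeries L) = epsSum fun n => epsFst U (L n) := by
  ext1 m
  rw [coeff_epsFst, coeff_epsSeries, epsSum, PowerSeries.coeff_mk, Prod.fst_sum]
  exact Finset.sum_congr rfl fun n _ => (coeff_epsFst _ _).symm

theorem m_epsSeries (F : ℕ → EpsDiffPoly U) :
    (epsCalculus U).m (epsSeries F) = epsSeries fun n => (epsCalculus U).m (F n) := by
  ext1 m
  simp only [epsCalculus_m, PowerSeries.coeff_map, coeff_epsSeries, map_sum]

/-- A differential operator with its adjoint. -/
theorem fst_sum_m_mul_D_pow (n : ℕ) (a : ℕ → DiffPoly U) :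
    (∑ s ∈ Finset.range n, (psiCalculus U).m (a s) * (psiCalculus U).D ^ s).1 =
      ∑ s ∈ Finset.range n, mulOp U (a s) * dOp U ^ s := by
  rw [Prod.fst_sum]
  refine Finset.sum_congr rfl fun s _ => ?_
  rw [Prod.fst_mul, Prod.pow_fst]
  rfl

theorem fst_sum_neg_D_pow_mul_m (n : ℕ) (a : ℕ → DiffPoly U) :
    (∑ s ∈ Finset.range n, (-(psiCalculus U).D) ^ s * (psiCalculus U).m (a s)).1 =
      ∑ s ∈ Finset.range n, (-dOp U) ^ s * mulOp U (a s) := by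
  rw [Prod.fst_sum]
  refine Finset.sum_congr rfl fun s _ => ?_
  rw [Prod.fst_mul, Prod.pow_fst]
  rfl

/-! ### Fréchet derivatives -/

/-- The Fréchet derivative paired with its adjoint. -/
def frechetPair (F : EpsDiffPoly U) (i : Fin N) : PowerSeries (AdjPair U) :=
  PowerSeries.mk fun n => ∑ s ∈ Finset.range (n + 1),
    (psiCalculus U).m (jetPartial i s (PowerSeries.coeff n F)) * (psiCalculus U).D ^ s

theorem frechetPair_mem {F : EpsDiffPoly U} (hF : F ∈ epsGrade (degGrade U) 0) (i : Fin N) :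
    frechetPair F i ∈ (epsCalculus U).Loc 0 := fun n => by
  rw [frechetPair, PowerSeries.coeff_mk]
  exact sum_mem fun s _ => mul_pow_mem_opGrade (jetPartial_mem_degGrade (hF n) i s) (by ring)

theorem coeff_mem_degGrade {F : EpsDiffPoly U} (hF : F ∈ epsGrade (degGrade U) 0) (n : ℕ) :
    PowerSeries.coeff n F ∈ degGrade U n := by
  simpa using hF n

/-- The coefficient of `ε^n` has degree `n`, so it involves no jet variable of order above `n`; the
sum over all orders equals the truncated one. -/
theorem epsFst_frechetPair {F : EpsDiffPoly U} (hF : F ∈ epsGrade (degGrade U) 0) (i : Fin N) :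
    epsFst U (frechetPair F i) = frechet F i := by
  ext1 n
  rw [coeff_epsFst, frechetPair, PowerSeries.coeff_mk, fst_sum_m_mul_D_pow, frechet,
    PowerSeries.coeff_mk, finsum_eq_sum_of_support_subset]
  intro s hs
  rw [Finset.coe_range, Set.mem_Iio]
  by_contra h
  refine hs ?_
  beta_reduce
  rw [jetPartial_eq_zero_of_mem_degGrade (coeff_mem_degGrade hF n) i (by omega), map_zero, zero_mul]

theorem epsFst_σ_frechetPair {F : EpsDiffPoly U} (hF : F ∈ epsGrade (degGrade U) 0) (i : Fin N) :
    epsFst U ((epsCalculus U).σ (frechetPair F i)) = frechetAdj F i := by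
  ext1 n
  rw [coeff_epsFst, epsCalculus_σ, coeff_epsMap, frechetPair, PowerSeries.coeff_mk,
    AdjointCalculus.σ_sum_mul_pow, fst_sum_neg_D_pow_mul_m, frechetAdj,
    PowerSeries.coeff_mk, finsum_eq_sum_of_support_subset]
  intro s hs
  rw [Finset.coe_range, Set.mem_Iio]
  by_contra h
  refine hs ?_
  beta_reduce
  rw [jetPartial_eq_zero_of_mem_degGrade (coeff_mem_degGrade hF n) i (by omega), map_zero, mul_zero]

/-- Each commutation of `∂` past `u^{i,s+1}` produces the next jet variable and a term ending in
`∂`, which joins the error `M`. -/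
theorem exists_D_pow_mul_X (i : Fin N) (s : ℕ) :
    ∃ M ∈ (psiCalculus U).Loc s, (psiCalculus U).D ^ s * (psiCalculus U).m (X (i, 0)) =
      (psiCalculus U).m (X (i, s)) + M * (psiCalculus U).D := by
  induction s with
  | zero => exact ⟨0, zero_mem _, by simp⟩
  | succ s ih =>
    obtain ⟨M, hM, h⟩ := ih
    refine ⟨(psiCalculus U).m (X (i, s)) + (psiCalculus U).D * M, add_mem ?_ ?_, ?_⟩
    · have := X_mem_degGrade (U := U) (i, s)
      rw [Nat.cast_succ]
      exact (psiCalculus U).m_mem this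
    · have hD : (psiCalculus U).D ∈ (psiCalculus U).Loc 1 :=
        D_mem_opGrade (isDiffGrading_degGrade U)
      exact (psiCalculus U).mul_mem_loc hD hM (by push_cast; ring)
    · have hX : (psiCalculus U).der (X (i, s)) = X (i, s + 1) := totalDeriv_X (i, s)
      rw [pow_succ', mul_assoc, h, mul_add, (psiCalculus U).comm, hX]
      noncomm_ring

/-- `∑ ℓ_{F,i} ∘ u^i_x` is the sum of `∂_x F` and an operator which ends with `∂_x`. -/
theorem sum_frechetPair_mul {F : EpsDiffPoly U} (hF : F ∈ epsGrade (degGrade U) 0) :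
    ∃ M ∈ (epsCalculus U).Loc 0,
      ∑ i, frechetPair F i * (epsCalculus U).m (PowerSeries.C (X (i, 0))) =
        (epsCalculus U).m (epsTotalDeriv F) + M * (epsCalculus U).D := by
  choose M hM h using fun (i : Fin N) (s : ℕ) => exists_D_pow_mul_X (U := U) i s
  refine ⟨PowerSeries.mk fun n => ∑ i, ∑ s ∈ Finset.range (n + 1),
    (psiCalculus U).m (jetPartial i s (PowerSeries.coeff n F)) * M i s, fun n => ?_, ?_⟩
  · rw [PowerSeries.coeff_mk]
    refine sum_mem fun i _ => sum_mem fun s _ => ?_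
    exact (psiCalculus U).mul_mem_loc
      ((psiCalculus U).m_mem (jetPartial_mem_degGrade (hF n) i s)) (hM i s) (by ring)
  · ext1 n
    rw [map_sum, map_add, epsCalculus_D, PowerSeries.coeff_mul_C, PowerSeries.coeff_mk,
      epsCalculus_m, PowerSeries.coeff_map, epsTotalDeriv, PowerSeries.coeff_mk,
      totalDeriv_eq_sum (coeff_mem_degGrade hF n), map_sum, Finset.sum_mul,
      ← Finset.sum_add_distrib]
    refine Finset.sum_congr rfl fun i _ => ?_
    rw [epsCalculus_m, PowerSeries.map_C, PowerSeries.coeff_mul_C, frechetPair,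
      PowerSeries.coeff_mk, map_sum, Finset.sum_mul, Finset.sum_mul, ← Finset.sum_add_distrib]
    refine Finset.sum_congr rfl fun s _ => ?_
    rw [mul_assoc, h, mul_add, map_mul, mul_assoc]

/-! ### Bivectors of localizable shape -/

namespace LocalizableBivector

variable (P : LocalizableBivector U)

/-- Half of the local part of a bivector, paired with its adjoint. -/
def halfLoc (i j : Fin N) : PowerSeries (AdjPair U) :=
  PowerSeries.mk fun d => ∑ s ∈ Finset.range (d + 2),
    (psiCalculus U).m (MvPolynomial.C (algebraMap ℝ (Smooth U) 2⁻¹) * P.loc d s i j) *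
      (psiCalculus U).D ^ s

theorem halfLoc_mem (i j : Fin N) : P.halfLoc i j ∈ (epsCalculus U).Loc 1 := fun n => by
  rw [halfLoc, PowerSeries.coeff_mk]
  refine sum_mem fun s hs => ?_
  have hs' := Finset.mem_range.1 hs
  have h := mul_mem_degGrade (C_mem_degGrade (algebraMap ℝ (Smooth U) 2⁻¹))
    (hasDegree_iff.1 (P.loc_degree n s i j (by omega)))
  exact mul_pow_mem_opGrade h (by rw [Nat.cast_sub (by omega)]; push_cast; ring)

theorem half_add_half (f : DiffPoly U) :
    MvPolynomial.C (algebraMap ℝ (Smooth U) 2⁻¹) * f +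
      MvPolynomial.C (algebraMap ℝ (Smooth U) 2⁻¹) * f = f := by
  rw [← add_mul, ← map_add, ← map_add]
  norm_num

/-- Halving is carried out by composing with multiplication by the constant function `1/2`. -/
theorem eq_of_add_self_eq {x y : PsiDO U} (h : x + x = y + y) : x = y := by
  have h2 : ∀ x : PsiDO U, mulOp U (MvPolynomial.C (algebraMap ℝ (Smooth U) 2⁻¹)) * (x + x) = x := by
    intro x
    rw [mul_add, ← add_mul, ← map_add]
    have := half_add_half (1 : DiffPoly U)
    rw [mul_one] at this
    rw [this, map_one, one_mul]
  rw [← h2 x, h, h2]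

/-- This is where the skewness of the local part of `P` enters: a skew operator is the
skew-symmetrization of its half. -/
theorem epsFst_halfLoc (i j : Fin N) :
    epsFst U (P.halfLoc i j - (epsCalculus U).σ (P.halfLoc j i)) =
      PowerSeries.mk fun d => ∑ s ∈ Finset.range (d + 2), mulOp U (P.loc d s i j) * dOp U ^ s := by
  ext1 d
  rw [coeff_epsFst, map_sub, epsCalculus_σ, coeff_epsMap, halfLoc, halfLoc, PowerSeries.coeff_mk,
    PowerSeries.coeff_mk, PowerSeries.coeff_mk, AdjointCalculus.σ_sum_mul_pow, Prod.fst_sub,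
    fst_sum_m_mul_D_pow, fst_sum_neg_D_pow_mul_m]
  set c : DiffPoly U := MvPolynomial.C (algebraMap ℝ (Smooth U) 2⁻¹) with hc
  have h1 : ∑ s ∈ Finset.range (d + 2), mulOp U (c * P.loc d s i j) * dOp U ^ s +
      ∑ s ∈ Finset.range (d + 2), mulOp U (c * P.loc d s i j) * dOp U ^ s =
      ∑ s ∈ Finset.range (d + 2), mulOp U (P.loc d s i j) * dOp U ^ s := by
    rw [← Finset.sum_add_distrib]
    refine Finset.sum_congr rfl fun s _ => ?_
    rw [← add_mul, ← map_add, half_add_half]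
  have h2 : ∑ s ∈ Finset.range (d + 2), (-dOp U) ^ s * mulOp U (c * P.loc d s j i) +
      ∑ s ∈ Finset.range (d + 2), (-dOp U) ^ s * mulOp U (c * P.loc d s j i) =
      ∑ s ∈ Finset.range (d + 2), (-dOp U) ^ s * mulOp U (P.loc d s j i) := by
    rw [← Finset.sum_add_distrib]
    refine Finset.sum_congr rfl fun s _ => ?_
    rw [← mul_add, ← map_add, half_add_half]
  have h3 : ∑ s ∈ Finset.range (d + 2), (-dOp U) ^ s * mulOp U (c * P.loc d s j i) =
      -∑ s ∈ Finset.range (d + 2), mulOp U (c * P.loc d s i j) * dOp U ^ s := by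
    refine eq_of_add_self_eq ?_
    rw [h2, P.loc_skew, ← h1, neg_add]
  rw [h3, sub_neg_eq_add, h1]

/-- The coefficients of the non-local part, as a series in `ε`. -/
def tailSeries (i : Fin N) : EpsDiffPoly U := PowerSeries.mk fun d => P.tail d i

theorem tailSeries_mem (i : Fin N) : P.tailSeries i ∈ epsGrade (degGrade U) 1 := fun n => by
  rw [tailSeries, PowerSeries.coeff_mk]
  exact_mod_cast hasDegree_iff.1 (P.tail_degree n i)

/-- The bivector, paired with its adjoint. -/
def opPair (i j : Fin N) : PowerSeries (AdjPair U) :=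
  P.halfLoc i j + (epsCalculus U).m (PowerSeries.C (X (i, 0))) * (epsCalculus U).Di *
      (epsCalculus U).m (P.tailSeries j) -
    (epsCalculus U).σ (P.halfLoc j i + (epsCalculus U).m (PowerSeries.C (X (j, 0))) *
      (epsCalculus U).Di * (epsCalculus U).m (P.tailSeries i))

theorem epsFst_opPair (i j : Fin N) : epsFst U (P.opPair i j) = P.op i j := by
  have h : P.opPair i j = (P.halfLoc i j - (epsCalculus U).σ (P.halfLoc j i)) +
      (epsCalculus U).m (PowerSeries.C (X (i, 0))) * (epsCalculus U).Di *
        (epsCalculus U).m (P.tailSeries j) +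
      (epsCalculus U).m (P.tailSeries i) * (epsCalculus U).Di *
        (epsCalculus U).m (PowerSeries.C (X (j, 0))) := by
    rw [opPair]
    simp only [map_add, AdjointCalculus.σ_mul, AdjointCalculus.σ_m, AdjointCalculus.σ_Di]
    noncomm_ring
  rw [h, map_add, map_add, epsFst_halfLoc]
  simp only [map_mul, epsFst_m, epsFst_Di]
  ext1 d
  have hC : ∀ f : DiffPoly U, epsMulOp U (PowerSeries.C f) = PowerSeries.C (mulOp U f) :=
    fun f => PowerSeries.map_C _ _
  have hop : P.op i j = PowerSeries.mk fun d =>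
      ∑ s ∈ Finset.range (d + 2), mulOp U (P.loc d s i j) * dOp U ^ s +
      mulOp U (X (i, 0)) * dInvOp U * mulOp U (P.tail d j) +
      mulOp U (P.tail d i) * dInvOp U * mulOp U (X (j, 0)) := by
    rw [← epsSeries_C]
    simp only [op, realize, Matrix.of_apply, hC, epsD, epsDInv, map_add, map_sum, map_mul, map_pow]
    rfl
  rw [hop, PowerSeries.coeff_mk, map_add, map_add, PowerSeries.coeff_mk, hC, hC, epsDInv,
    ← map_mul, PowerSeries.coeff_C_mul, PowerSeries.coeff_mul_C, PowerSeries.coeff_mul_C,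
    epsMulOp, PowerSeries.coeff_map, PowerSeries.coeff_map, tailSeries, tailSeries,
    PowerSeries.coeff_mk, PowerSeries.coeff_mk]

end LocalizableBivector

end Hat

/-! ### Change of coordinates in local operators -/

namespace Transformation

open MvPolynomial (X)

variable {N : ℕ} {U W : TopologicalSpace.Opens (Fin N → ℝ)} (T : Transformation U W)

/-- `∂_y`, paired with its adjoint. -/
def dYPair : PowerSeries (AdjPair U) := (epsCalculus U).m T.Binv * (epsCalculus U).D

/-- Multiplication by differential polynomials in the coordinates `(y, w)`. -/
def substMul : DiffPoly W →+* PowerSeries (AdjPair U) := (epsCalculus U).m.comp T.substHom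

theorem substMul_apply (f : DiffPoly W) : T.substMul f = (epsCalculus U).m (T.substHom f) := rfl

theorem m_Binv_mul_m_B : (epsCalculus U).m T.Binv * (epsCalculus U).m T.B = 1 := by
  rw [← map_mul, Binv_mul_B, map_one]

theorem dYPair_mul_substMul (f : DiffPoly W) :
    T.dYPair * T.substMul f = T.substMul f * T.dYPair + T.substMul (totalDeriv f) := by
  rw [substMul_apply, substMul_apply, substHom_totalDeriv, dYPair, mul_assoc,
    (epsCalculus U).comm, epsCalculus_der, mul_add, ← mul_assoc, ← mul_assoc, ← map_mul, ← map_mul,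
    ← map_mul, mul_comm]

/-- The leading part of `∂_y`. -/
def dYLead : AdjPair U :=
  (psiCalculus U).m (PowerSeries.constantCoeff T.Binv) * (psiCalculus U).D

theorem constantCoeff_dYPair : PowerSeries.constantCoeff T.dYPair = T.dYLead := by
  rw [dYPair, map_mul, epsCalculus_D, PowerSeries.constantCoeff_C, epsCalculus_m,
    ← PowerSeries.coeff_zero_eq_constantCoeff_apply, PowerSeries.coeff_map,
    PowerSeries.coeff_zero_eq_constantCoeff_apply]
  rfl

theorem constantCoeff_substMul (f : DiffPoly W) :
    PowerSeries.constantCoeff (T.substMul f) = (psiCalculus U).m (T.substLead f) := by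
  rw [substMul_apply, epsCalculus_m, ← PowerSeries.coeff_zero_eq_constantCoeff_apply,
    PowerSeries.coeff_map, PowerSeries.coeff_zero_eq_constantCoeff_apply]
  rfl

theorem dYLead_mul (f : DiffPoly W) :
    T.dYLead * ((psiCalculus U).m.comp T.substLead) f =
      ((psiCalculus U).m.comp T.substLead) f * T.dYLead +
        ((psiCalculus U).m.comp T.substLead) (totalDeriv f) := by
  have h := congrArg PowerSeries.constantCoeff (T.dYPair_mul_substMul f)
  simp only [map_mul, map_add, constantCoeff_dYPair, constantCoeff_substMul] at h
  exact h

/-- Coefficients over `U` are leading substitutions of coefficients over `W`, and `∂_x = H_0 ∂_y` to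
leading order; products stay within the grade by the commutation relation of `∂_y`. -/
theorem opGrade_le (z : ℤ) :
    opGrade (psiCalculus U).m (psiCalculus U).D (degGrade U) z ≤
      opGrade ((psiCalculus U).m.comp T.substLead) T.dYLead (degGrade W) z := by
  have hm : ∀ {r : ℤ} {a : DiffPoly U}, a ∈ degGrade U r → (psiCalculus U).m a ∈
      opGrade ((psiCalculus U).m.comp T.substLead) T.dYLead (degGrade W) r := by
    intro r a ha
    obtain ⟨g, hg, rfl⟩ := T.exists_substLead_eq ha
    exact map_mem_opGrade (m := (psiCalculus U).m.comp T.substLead) hg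
  have hg := isDiffGrading_degGrade W
  have hD : (psiCalculus U).D ∈
      opGrade ((psiCalculus U).m.comp T.substLead) T.dYLead (degGrade W) 1 := by
    have h : (psiCalculus U).D = (psiCalculus U).m (T.H 0) * T.dYLead := by
      rw [dYLead, ← mul_assoc, ← map_mul, ← constantCoeff_B, ← map_mul, B_mul_Binv, map_one,
        map_one, one_mul]
    rw [h]
    have := mul_mem_opGrade hg T.dYLead_mul (hm (hasDegree_iff.1 (T.H_degree 0)))
      (D_mem_opGrade hg)
    simpa using this
  have hDs : ∀ s : ℕ, (psiCalculus U).D ^ s ∈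
      opGrade ((psiCalculus U).m.comp T.substLead) T.dYLead (degGrade W) s := by
    intro s
    induction s with
    | zero =>
      have := hm (isDiffGrading_degGrade U).one_mem
      simpa using this
    | succ s ih =>
      have := mul_mem_opGrade hg T.dYLead_mul ih hD
      rw [pow_succ]
      exact_mod_cast this
  rw [opGrade, AddSubgroup.closure_le]
  rintro x ⟨r, s, a, ha, h, rfl⟩
  rw [← h]
  exact mul_mem_opGrade hg T.dYLead_mul (hm ha) (hDs s)

theorem dYPair_pow_mem (s : ℕ) : T.dYPair ^ s ∈ (epsCalculus U).Loc s := by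
  have hD : (epsCalculus U).D ∈ (epsCalculus U).Loc 1 :=
    C_mem_epsGrade (D_mem_opGrade (isDiffGrading_degGrade U))
  have h1 : T.dYPair ∈ (epsCalculus U).Loc 1 :=
    (epsCalculus U).mul_mem_loc ((epsCalculus U).m_mem (k := 0) T.Binv_mem) hD (zero_add 1)
  induction s with
  | zero =>
    rw [pow_zero, ← map_one (epsCalculus U).m]
    exact (epsCalculus U).m_mem (C_mem_epsGrade (isDiffGrading_degGrade U).one_mem)
  | succ s ih =>
    rw [pow_succ]
    exact (epsCalculus U).mul_mem_loc ih h1 (by push_cast; rfl)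

/-- Every local operator is an `ε`-series of differential operators in the coordinates `(y, w)`. -/
theorem exists_eq_epsSeries_dYPair {k : ℕ} {L : PowerSeries (AdjPair U)}
    (hL : L ∈ (epsCalculus U).Loc k) :
    ∃ a : ℕ → ℕ → DiffPoly W, (∀ n s : ℕ, a n s ∈ degGrade W ((k + n : ℕ) - s)) ∧
      L = epsSeries fun n =>
        ∑ s ∈ Finset.range (k + n + 1), T.substMul (a n s) * T.dYPair ^ s := by
  obtain ⟨y, hy, hL⟩ := exists_eq_epsSeries
    (𝒢 := opGrade (psiCalculus U).m (psiCalculus U).D (degGrade U))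
    (fun k y => ∃ a : ℕ → DiffPoly W, (∀ s : ℕ, a s ∈ degGrade W (k - s)) ∧
      y = ∑ s ∈ Finset.range (k + 1), T.substMul (a s) * T.dYPair ^ s)
    (fun k y ⟨a, ha, h⟩ => by
      rw [h]
      change _ ∈ (epsCalculus U).Loc k
      exact sum_mem fun s _ => (epsCalculus U).mul_mem_loc
        ((epsCalculus U).m_mem (T.substHom_mem (ha s))) (T.dYPair_pow_mem s) (by ring))
    (fun k x hx => by
      obtain ⟨a, ha, h⟩ := exists_eq_sum_of_mem_opGrade (isDiffGrading_degGrade W)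
        (T.opGrade_le k hx)
      refine ⟨_, ⟨a, ha, rfl⟩, ?_⟩
      rw [h, map_sum]
      refine Finset.sum_congr rfl fun s _ => ?_
      rw [map_mul, map_pow, constantCoeff_dYPair, constantCoeff_substMul]
      rfl) hL
  choose a ha hay using hy
  exact ⟨a, ha, by rw [hL]; congr 1; exact funext hay⟩

/-- The adjoint with respect to `dy` of a differential operator in the coordinates `(y, w)`. -/
theorem m_Binv_mul_σ_mul_m_B (n : ℕ) (a : ℕ → DiffPoly W) :
    (epsCalculus U).m T.Binv *
      ((epsCalculus U).σ (∑ s ∈ Finset.range n, T.substMul (a s) * T.dYPair ^ s) *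
        (epsCalculus U).m T.B) =
      ∑ s ∈ Finset.range n, T.substMul (adjCoeff totalDeriv n a s) * T.dYPair ^ s := by
  rw [← sum_neg_pow_mul_map T.dYPair_mul_substMul, map_sum, Finset.sum_mul, Finset.mul_sum]
  refine Finset.sum_congr rfl fun s _ => ?_
  -- The adjoint of `∂_y = B⁻¹ ∂_x` is `-∂_x B⁻¹`; moving `B⁻¹` through its powers turns each factor
  -- into `-∂_y`.
  have hs : ∀ s : ℕ, (epsCalculus U).m T.Binv *
      (-((epsCalculus U).D * (epsCalculus U).m T.Binv)) ^ s =
      (-T.dYPair) ^ s * (epsCalculus U).m T.Binv := by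
    intro s
    induction s with
    | zero => simp
    | succ s ih =>
      rw [pow_succ, ← mul_assoc, ih, pow_succ, dYPair]
      noncomm_ring
  have hc : (epsCalculus U).m T.Binv * T.substMul (a s) * (epsCalculus U).m T.B =
      T.substMul (a s) := by
    rw [substMul_apply, ← map_mul, ← map_mul, mul_right_comm, Binv_mul_B, one_mul]
  have hσ : (epsCalculus U).σ (T.substMul (a s) * T.dYPair ^ s) =
      (-((epsCalculus U).D * (epsCalculus U).m T.Binv)) ^ s * T.substMul (a s) := by
    rw [AdjointCalculus.σ_mul, AdjointCalculus.σ_pow, dYPair, AdjointCalculus.σ_mul,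
      AdjointCalculus.σ_D, AdjointCalculus.σ_m, substMul_apply, AdjointCalculus.σ_m, neg_mul]
  rw [hσ, ← mul_assoc, ← mul_assoc, hs, mul_assoc, mul_assoc, ← mul_assoc (_ : PowerSeries _)
    (T.substMul (a s)), hc]

/-! ### The transformed bivector -/

/-- The entries of `𝒟`, paired with their adjoints. -/
def calDPair (h i : Fin N) : PowerSeries (AdjPair U) :=
  (epsCalculus U).m T.B * frechetPair (T.Q h) i -
    (epsCalculus U).m (epsTotalDeriv (T.Q h)) * (epsCalculus U).Di * frechetPair T.B i

theorem epsFst_calDPair (h i : Fin N) : epsFst U (T.calDPair h i) = T.calD h i := by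
  rw [calDPair, calD, Matrix.of_apply, map_sub, map_mul, map_mul, map_mul, epsFst_m, epsFst_m,
    epsFst_Di, epsFst_frechetPair (T.Q_mem h), epsFst_frechetPair T.B_mem]

theorem epsFst_σ_calDPair (h i : Fin N) :
    epsFst U ((epsCalculus U).σ (T.calDPair h i)) = T.calDAdj i h := by
  rw [calDPair, map_sub, AdjointCalculus.σ_mul, AdjointCalculus.σ_mul, AdjointCalculus.σ_mul,
    AdjointCalculus.σ_m, AdjointCalculus.σ_m, AdjointCalculus.σ_Di, calDAdj, Matrix.of_apply,
    map_sub, map_mul, map_mul, map_mul, map_neg, epsFst_m, epsFst_m, epsFst_Di,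
    epsFst_σ_frechetPair (T.Q_mem h), epsFst_σ_frechetPair T.B_mem]
  noncomm_ring

theorem act_apply (P : LocalizableBivector U) (h k : Fin N) :
    T.act P.op h k = epsFst U ((epsCalculus U).m T.Binv *
      ∑ i, ∑ j, T.calDPair h i * P.opPair i j * (epsCalculus U).σ (T.calDPair k j)) := by
  rw [act, Matrix.mul_apply, map_mul, map_sum, epsFst_m, Finset.mul_sum]
  simp only [Matrix.mul_apply, Matrix.of_apply, map_sum, map_mul, epsFst_calDPair,
    epsFst_σ_calDPair, LocalizableBivector.epsFst_opPair, Finset.sum_mul, Finset.mul_sum]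
  rw [Finset.sum_comm]
  refine Finset.sum_congr rfl fun i _ => Finset.sum_congr rfl fun j _ => ?_
  noncomm_ring

/-- The decomposition of the transformed bivector into a local and a non-local part. -/
theorem exists_act_decomposition (P : LocalizableBivector U) :
    ∃ (Λ : Fin N → Fin N → PowerSeries (AdjPair U)) (F : Fin N → EpsDiffPoly U),
      (∀ h k, Λ h k ∈ (epsCalculus U).Loc 1) ∧ (∀ k, F k ∈ epsGrade (degGrade U) 1) ∧
      ∀ h k, T.act P.op h k = epsFst U ((epsCalculus U).m T.Binv *
        (Λ h k - (epsCalculus U).σ (Λ k h) +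
          (epsCalculus U).m (epsTotalDeriv (T.Q h)) * (epsCalculus U).Di * (epsCalculus U).m (F k) +
          (epsCalculus U).m (F h) * (epsCalculus U).Di *
            (epsCalculus U).m (epsTotalDeriv (T.Q k)))) := by
  choose Mq hMq hlu using fun h => sum_frechetPair_mul (T.Q_mem h)
  obtain ⟨Mb, hMb, hβu⟩ := sum_frechetPair_mul T.B_mem
  obtain ⟨Λ, F, hΛ, hF, h⟩ := (epsCalculus U).transform_shape (B := T.B) T.B_mem
    (q := fun h => epsTotalDeriv (T.Q h)) (u := fun i => PowerSeries.C (X (i, 0)))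
    (V := P.tailSeries) (fun h => epsTotalDeriv_mem (T.Q_mem h)) P.tailSeries_mem
    (l := fun h i => frechetPair (T.Q h) i) (β := fun i => frechetPair T.B i)
    (fun h i => frechetPair_mem (T.Q_mem h) i) (fun i => frechetPair_mem T.B_mem i)
    hMq hMb hlu hβu (Y := P.halfLoc) P.halfLoc_mem
  exact ⟨Λ, F, hΛ, hF, fun i k => by rw [act_apply, ← h]; rfl⟩

end Transformation

/-- The bivector with local part the skew-symmetrization of `∑ a_s^{ij} ∂_y^s`. -/
def LocalizableBivector.ofSkew {N : ℕ} {W : TopologicalSpace.Opens (Fin N → ℝ)}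
    (a : Fin N → Fin N → ℕ → ℕ → DiffPoly W)
    (ha : ∀ i j (n s : ℕ), a i j n s ∈ degGrade W ((1 + n : ℕ) - s))
    (v : Fin N → ℕ → DiffPoly W) (hv : ∀ i (n : ℕ), v i n ∈ degGrade W ((1 + n : ℕ) : ℤ)) :
    LocalizableBivector W where
  loc d s i j := a i j d s - adjCoeff totalDeriv (d + 2) (a j i d) s
  tail d i := v i d
  loc_degree d s i j hs := by
    rw [hasDegree_iff, Nat.cast_sub hs, add_comm d 1]
    exact sub_mem (ha i j d s) (adjCoeff_mem (isDiffGrading_degGrade W) (ha j i d) _ s)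
  tail_degree d i := by
    rw [hasDegree_iff, add_comm d 1]
    exact hv i d
  loc_skew d i j := by
    have hx : ∀ i j, ∑ s ∈ Finset.range (d + 2),
        (psiCalculus W).m (a i j d s - adjCoeff totalDeriv (d + 2) (a j i d) s) *
          (psiCalculus W).D ^ s =
        ∑ s ∈ Finset.range (d + 2), (psiCalculus W).m (a i j d s) * (psiCalculus W).D ^ s -
        (psiCalculus W).σ (∑ s ∈ Finset.range (d + 2),
          (psiCalculus W).m (a j i d s) * (psiCalculus W).D ^ s) := by
      intro i j
      rw [AdjointCalculus.σ_sum_mul_pow, sum_neg_pow_mul_map (psiCalculus W).comm,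
        ← Finset.sum_sub_distrib]
      refine Finset.sum_congr rfl fun s _ => ?_
      rw [map_sub, sub_mul]
    -- The local operator is `x_{ij} - σ x_{ji}`, which is skew because `σ` is an involution.
    rw [← fst_sum_neg_D_pow_mul_m, ← fst_sum_m_mul_D_pow, ← AdjointCalculus.σ_sum_mul_pow, hx, hx,
      map_sub, AdjointCalculus.σ_σ, ← Prod.fst_neg, neg_sub]

/-! ### Assembly of the bivector in the coordinates `(y, w)` -/

namespace Transformation

open MvPolynomial (X)

variable {N : ℕ} {U W : TopologicalSpace.Opens (Fin N → ℝ)} (T : Transformation U W)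

theorem substHom_X_zero (i : Fin N) :
    T.substHom (X (i, 0)) = T.Binv * epsTotalDeriv (T.Q i) := by
  rw [substHom_X]
  rfl

/-- `∂_y⁻¹`, paired with its adjoint. -/
def dYInvPair : PowerSeries (AdjPair U) := (epsCalculus U).Di * (epsCalculus U).m T.B

/-- Rewrites `∂_x⁻¹` as `∂_y⁻¹ B⁻¹`, so that both outer functions acquire a factor `B⁻¹`. For `∂_x
Q` this gives `w_y`, and for `F` the new tail. -/
theorem m_Binv_mul_nonlocal (F G : EpsDiffPoly U) :
    (epsCalculus U).m T.Binv * ((epsCalculus U).m F * (epsCalculus U).Di * (epsCalculus U).m G) =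
      (epsCalculus U).m (T.Binv * F) * T.dYInvPair * (epsCalculus U).m (T.Binv * G) := by
  have h : (epsCalculus U).m G = (epsCalculus U).m T.B * (epsCalculus U).m (T.Binv * G) := by
    rw [← map_mul, ← mul_assoc, B_mul_Binv, one_mul]
  rw [h, map_mul _ T.Binv F, dYInvPair]
  simp only [mul_assoc]

/-- The operator of a bivector given in the coordinates `(y, w)`, in terms of pairs. -/
theorem opIn_apply (P : LocalizableBivector W) (i j : Fin N) :
    P.opIn T i j = epsFst U (epsSeries fun d =>
      ∑ s ∈ Finset.range (d + 2), T.substMul (P.loc d s i j) * T.dYPair ^ s +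
        T.substMul (X (i, 0)) * T.dYInvPair * T.substMul (P.tail d j) +
        T.substMul (P.tail d i) * T.dYInvPair * T.substMul (X (j, 0))) := by
  rw [epsFst_epsSeries, LocalizableBivector.opIn, LocalizableBivector.realize, Matrix.of_apply]
  congr 1
  funext d
  simp only [map_add, map_sum, map_mul, map_pow, substMul_apply, dYPair, dYInvPair, epsFst_m,
    epsFst_D, epsFst_Di, subst_eq, dY, dYInv]

/-- A Miura-reciprocal transformation preserves the localizable shape. -/
theorem exists_opIn_eq_act (P : LocalizableBivector U) :
    ∃ P' : LocalizableBivector W, P'.opIn T = T.act P.op := by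
  obtain ⟨Λ, F, hΛ, hF, hact⟩ := T.exists_act_decomposition P
  have hB : ∀ {k : ℤ} {G : EpsDiffPoly U}, G ∈ epsGrade (degGrade U) k →
      T.Binv * G ∈ epsGrade (degGrade U) k := fun hG => by
    simpa using mul_mem_epsGrade mul_mem_degGrade T.Binv_mem hG
  choose v hv hFv using fun i => T.exists_eq_epsSeries_substHom (k := 1) (hB (hF i))
  choose a ha hΛa using fun i j => T.exists_eq_epsSeries_dYPair (k := 1)
    ((epsCalculus U).mul_mem_loc ((epsCalculus U).m_mem T.Binv_mem) (hΛ i j) (zero_add 1))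
  refine ⟨LocalizableBivector.ofSkew a ha v hv, ?_⟩
  ext1 i j
  rw [opIn_apply, hact]
  congr 1
  have hσ : (epsCalculus U).m T.Binv * (epsCalculus U).σ (Λ j i) = epsSeries fun d =>
      ∑ s ∈ Finset.range (d + 2),
        T.substMul (adjCoeff totalDeriv (d + 2) (a j i d) s) * T.dYPair ^ s := by
    -- The lifted coefficients belong to `B⁻¹ Λ`, not to `Λ`. Restoring the factor `B` yields the
    -- adjoint `B⁻¹ (·)* B` with respect to `dy`.
    have h : (epsCalculus U).σ (Λ j i) =
        (epsCalculus U).σ ((epsCalculus U).m T.Binv * Λ j i) * (epsCalculus U).m T.B := by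
      rw [AdjointCalculus.σ_mul, AdjointCalculus.σ_m, mul_assoc, m_Binv_mul_m_B, mul_one]
    rw [h, hΛa, epsCalculus_σ, epsMap_epsSeries, epsSeries_mul, mul_epsSeries]
    congr 1
    funext d
    rw [← epsCalculus_σ, m_Binv_mul_σ_mul_m_B, show 1 + d + 1 = d + 2 by omega]
  have hm : ∀ i, (epsCalculus U).m (T.Binv * F i) = epsSeries fun d => T.substMul (v i d) :=
    fun i => by rw [hFv, m_epsSeries]; rfl
  rw [mul_add, mul_add, mul_sub, m_Binv_mul_nonlocal, m_Binv_mul_nonlocal, hσ, hΛa, hm, hm,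
    ← substHom_X_zero, ← substHom_X_zero, ← substMul_apply, ← substMul_apply, mul_epsSeries,
    epsSeries_mul, epsSeries_mul, ← epsSeries_sub, ← epsSeries_add, ← epsSeries_add]
  congr 1
  funext d
  rw [show 1 + d + 1 = d + 2 by omega, ← Finset.sum_sub_distrib]
  simp only [LocalizableBivector.ofSkew, map_sub, sub_mul]

end Transformation

end MiuraReciprocal

end

theorem mainTheorem7 {N : ℕ} (U W : TopologicalSpace.Opens (Fin N → ℝ))
    (T : MiuraReciprocal.Transformation U W) (P : MiuraReciprocal.LocalizableBivector U) :
    ∃ P' : MiuraReciprocal.LocalizableBivector W, P'.opIn T = T.act P.op :=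
  T.exists_opIn_eq_act P
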